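/- Let $n\ge 3$ be an integer, $\gamma>0$ and let $q\in L_{\gamma+n/2}(\mathbb R^n)$ be complex-valued. Let $H$ be the Schrödinger operator $-\Delta+q$ in $L_2(\mathbb R^n)$, that is, the (in general non-self-adjoint) operator with domain $$D(H)=\{u\in H^1(\mathbb R^n):\ |q|^{1/2}u\in L_2(\mathbb R^n),\ -\Delta u+qu\in L_2(\mathbb R^n)\},\qquad Hu=-\Delta u+qu,$$ where $-\Delta u+qu$ is understood in the sense of tempered distributions. Then every eigenvalue $\lambda\in\mathbb C$ of $H$ with $\operatorname{Im}\lambda\ne 0$ satisfies $$|\operatorname{Im}\lambda|^{\gamma}\ \le\ (4\pi)^{-n/2}\,\Gamma\!\left(\frac{2\gamma}{2\gamma+n}\right)^{\gamma+n/2}\int_{\mathbb R^n}|q(x)|^{\gamma+n/2}\,dx .$$ -/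

import Mathlib

open MeasureTheory TemperedDistribution
open scoped SchwartzMap Laplacian ENNReal

/-- The complex Hilbert space `L₂(ℝⁿ)`. -/
abbrev L2 (n : ℕ) : Type :=
  Lp ℂ 2 (volume : Measure (EuclideanSpace ℝ (Fin n)))

/-- The graph of the Schrödinger operator `-Δ + q` in `L₂(ℝⁿ)`: the pairs `(u, f)` of elements of
`L₂(ℝⁿ)` such that `u` belongs to the form domain, that is `u ∈ H¹(ℝⁿ)` and `|q|^{1/2} u ∈ L₂(ℝⁿ)`,
and `-Δu + qu = f` as tempered distributions (in particular `qu` is one). -/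
noncomputable def schrodingerGraph {n : ℕ} (q : EuclideanSpace ℝ (Fin n) → ℂ) :
    Submodule ℂ (L2 n × L2 n) where
  carrier := {p |
    MemSobolev 1 2 (p.1 : 𝓢'(EuclideanSpace ℝ (Fin n), ℂ)) ∧
    MemLp (fun x => (Real.sqrt ‖q x‖ : ℂ) * p.1 x) 2 volume ∧
    ∀ φ : 𝓢(EuclideanSpace ℝ (Fin n), ℂ),
      Integrable (fun x => q x * p.1 x * φ x) volume ∧
      -(Δ (p.1 : 𝓢'(EuclideanSpace ℝ (Fin n), ℂ))) φ + ∫ x, q x * p.1 x * φ x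
        = (p.2 : 𝓢'(EuclideanSpace ℝ (Fin n), ℂ)) φ}
  zero_mem' := by
    have hz : ((0 : L2 n) : 𝓢'(EuclideanSpace ℝ (Fin n), ℂ)) = 0 := by
      rw [← Lp.toTemperedDistributionCLM_apply, map_zero]
    refine ⟨?_, ?_, fun φ => ?_⟩
    · simp only [Prod.fst_zero, hz]
      exact memSobolev_fun_zero _ _ _ _
    · refine (MemLp.zero (ε := ℂ)).ae_eq ?_
      filter_upwards with x
      simp
    · have he : (fun x => q x * (0 : L2 n) x * φ x) =ᵐ[volume] fun _ => (0 : ℂ) := by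
        filter_upwards with x
        simp
      refine ⟨(integrable_zero _ _ _).congr he.symm, ?_⟩
      simp only [Prod.fst_zero, Prod.snd_zero]
      rw [integral_congr_ae he, laplacian_apply_apply, hz]
      simp
  add_mem' := by
    rintro ⟨u, f⟩ ⟨v, g⟩ ⟨hu1, hu2, hu3⟩ ⟨hv1, hv2, hv3⟩
    have hadd := Lp.coeFn_add u v
    have ha : ∀ a b : L2 n, ((a + b : L2 n) : 𝓢'(EuclideanSpace ℝ (Fin n), ℂ)) = a + b := by
      intro a b
      simp only [← Lp.toTemperedDistributionCLM_apply, map_add]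
    refine ⟨?_, ?_, fun φ => ?_⟩
    · simp only [Prod.mk_add_mk, ha]
      exact hu1.add hv1
    · refine (hu2.add hv2).ae_eq ?_
      filter_upwards [hadd] with x hx
      simp only [Prod.mk_add_mk, hx, Pi.add_apply]
      ring
    · have he : (fun x => q x * (u + v : L2 n) x * φ x) =ᵐ[volume]
          fun x => q x * u x * φ x + q x * v x * φ x := by
        filter_upwards [hadd] with x hx
        simp only [hx, Pi.add_apply]
        ring
      refine ⟨((hu3 φ).1.add (hv3 φ).1).congr he.symm, ?_⟩
      have e1 := (hu3 φ).2
      have e2 := (hv3 φ).2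
      simp only [laplacian_apply_apply] at e1 e2 ⊢
      simp only [Prod.mk_add_mk, ha]
      change -((u : 𝓢'(EuclideanSpace ℝ (Fin n), ℂ)) (Δ φ) +
        (v : 𝓢'(EuclideanSpace ℝ (Fin n), ℂ)) (Δ φ)) + _ =
        (f : 𝓢'(EuclideanSpace ℝ (Fin n), ℂ)) φ + (g : 𝓢'(EuclideanSpace ℝ (Fin n), ℂ)) φ
      rw [integral_congr_ae he, integral_add (hu3 φ).1 (hv3 φ).1, ← e1, ← e2]
      ring
  smul_mem' := by
    rintro c ⟨u, f⟩ ⟨hu1, hu2, hu3⟩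
    have hsm := Lp.coeFn_smul c u
    have ha : ∀ a : L2 n, ((c • a : L2 n) : 𝓢'(EuclideanSpace ℝ (Fin n), ℂ)) =
        c • (a : 𝓢'(EuclideanSpace ℝ (Fin n), ℂ)) := by
      intro a
      simp only [← Lp.toTemperedDistributionCLM_apply, map_smul]
    refine ⟨?_, ?_, fun φ => ?_⟩
    · simp only [Prod.smul_mk, ha]
      exact hu1.smul c
    · refine (hu2.const_smul c).ae_eq ?_
      filter_upwards [hsm] with x hx
      simp only [Prod.smul_mk, hx, Pi.smul_apply, smul_eq_mul]
      ring
    · have he : (fun x => q x * (c • u : L2 n) x * φ x) =ᵐ[volume]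
          fun x => c * (q x * u x * φ x) := by
        filter_upwards [hsm] with x hx
        simp only [hx, Pi.smul_apply, smul_eq_mul]
        ring
      refine ⟨((hu3 φ).1.const_mul c).congr he.symm, ?_⟩
      have e1 := (hu3 φ).2
      simp only [laplacian_apply_apply] at e1 ⊢
      simp only [Prod.smul_mk, ha]
      change -(c * (u : 𝓢'(EuclideanSpace ℝ (Fin n), ℂ)) (Δ φ)) + _ =
        c * (f : 𝓢'(EuclideanSpace ℝ (Fin n), ℂ)) φ
      rw [integral_congr_ae he, integral_const_mul, ← e1]
      ring

/-- The relation `schrodingerGraph q` is single-valued. -/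
theorem schrodingerGraph_snd_eq_zero {n : ℕ} (q : EuclideanSpace ℝ (Fin n) → ℂ)
    (p : L2 n × L2 n) (hp : p ∈ schrodingerGraph q) (h : p.1 = 0) : p.2 = 0 := by
  obtain ⟨u, f⟩ := p
  obtain rfl : u = 0 := h
  have hf : Lp.toTemperedDistributionCLM ℂ volume 2 f = 0 := by
    ext φ
    have e := (hp.2.2 φ).2
    have he : (fun x => q x * (0 : L2 n) x * φ x) =ᵐ[volume] fun _ => (0 : ℂ) := by
      filter_upwards with x
      simp
    have hz : ((0 : L2 n) : 𝓢'(EuclideanSpace ℝ (Fin n), ℂ)) = 0 := by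
      rw [← Lp.toTemperedDistributionCLM_apply, map_zero]
    simp only at e
    rw [integral_congr_ae he, laplacian_apply_apply, hz] at e
    rw [Lp.toTemperedDistributionCLM_apply, ← e]
    simp
  have hk := Lp.ker_toTemperedDistributionCLM_eq_bot (E := EuclideanSpace ℝ (Fin n)) (F := ℂ)
    (μ := volume) (p := 2)
  have : f ∈ (Lp.toTemperedDistributionCLM ℂ
      (volume : Measure (EuclideanSpace ℝ (Fin n))) 2).ker := hf
  rw [hk] at this
  exact this

/-- The Schrödinger operator `H = -Δ + q` in `L₂(ℝⁿ)`, as an unbounded operator: its domain consists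
of the `u ∈ H¹(ℝⁿ)` with `|q|^{1/2} u ∈ L₂(ℝⁿ)` and `-Δu + qu ∈ L₂(ℝⁿ)`, and `Hu = -Δu + qu`. -/
noncomputable def schrodingerOperator {n : ℕ} (q : EuclideanSpace ℝ (Fin n) → ℂ) :
    L2 n →ₗ.[ℂ] L2 n :=
  (schrodingerGraph q).toLinearPMap

/-- The graph of `schrodingerOperator q` is `schrodingerGraph q`. -/
theorem schrodingerOperator_graph {n : ℕ} (q : EuclideanSpace ℝ (Fin n) → ℂ) :
    (schrodingerOperator q).graph = schrodingerGraph q :=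
  Submodule.toLinearPMap_graph_eq _ (schrodingerGraph_snd_eq_zero q)

/-- `z` is an eigenvalue of the unbounded operator `T`. -/
def LinearPMap.IsEigenvalue {H : Type*} [AddCommGroup H] [Module ℂ H] (T : H →ₗ.[ℂ] H) (z : ℂ) :
    Prop :=
  ∃ u : T.domain, (u : H) ≠ 0 ∧ T u = z • (u : H)

/-! Birman–Schwinger argument in the time domain. Put `ρ = γ + n/2` and `v = |q|^{1/2} u`, and write
`q u = |q|^{1/2} h` with `|h| ≤ |v|`. For an eigenfunction with nonreal `z`, `u` is minus the free
resolvent at `z` applied to `q u`, and that resolvent is a Laplace transform of the Schrödinger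
group: up to a unimodular factor it is `∫₀^∞ e^{iσzt} e^{iσtΔ} dt`, where the sign `σ` is that of
`Im z`, so that the integrand decays like `e^{-|Im z| t}`.

Everything then rests on the norm of `|q|^{1/2} e^{iσtΔ} |q|^{1/2}` on `L₂`. With `w = |q|^{ρ/2}`,
consider `w^ω e^{iσtΔ} w^ω`. On `Re ω = 0` its norm is at most `1`; on `Re ω = 1` the kernel bound
`(4πt)^{-n/2}` and Cauchy–Schwarz give `(4πt)^{-n/2} ∫ |q|^ρ`. The three lines theorem at `ω = 1/ρ`
gives `((4πt)^{-n/2} ∫ |q|^ρ)^{1/ρ}` (`norm_heatPairing_weighted_le`). Integrating in time produces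
a Gamma integral `J` (`integral_exp_mul_rpow`), and `‖v‖ ≤ J ‖v‖` with `v ≠ 0` forces `1 ≤ J`; the
`ρ`-th power of this is the claim.

The group has no absolutely convergent kernel on `L₂`, so time is replaced by `ζ = ε + iσt` with `ε
> 0`, where the kernel is Gaussian, and `ε → 0` at the end. Only the bilinear pairing `heatPairing`
is used, never an operator. Since `y ↦ heatKernel ζ (x - y)` is a Schwartz function, the
distributional equation can be tested on it directly (`hasDerivAt_heatPairing_of_eigenfunction`),
which replaces the construction of the resolvent by a Duhamel formula
(`norm_integral_mul_le_of_eigenfunction`). -/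

open Filter Topology Complex

/-! ### Complex Gaussians as Schwartz functions, and their Laplacian -/

section Gaussian

variable {V : Type*} [NormedAddCommGroup V] [InnerProductSpace ℝ V]

theorem one_add_pow_mul_exp_neg_mul_sq_le {c : ℝ} (hc : 0 < c) (k : ℕ) {r : ℝ} (hr : 0 ≤ r) :
    (1 + r) ^ k * Real.exp (-c * r ^ 2) ≤ k.factorial * Real.exp (1 + 1 / (4 * c)) := by
  have h1 : (1 + r) ^ k ≤ k.factorial * Real.exp (1 + r) := by
    have := Real.pow_div_factorial_le_exp (1 + r) (by linarith) k
    rwa [div_le_iff₀ (by positivity), mul_comm] at this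
  calc (1 + r) ^ k * Real.exp (-c * r ^ 2)
      ≤ k.factorial * Real.exp (1 + r) * Real.exp (-c * r ^ 2) := by gcongr
    _ = k.factorial * Real.exp (1 + r + -c * r ^ 2) := by rw [mul_assoc, ← Real.exp_add]
    _ ≤ k.factorial * Real.exp (1 + 1 / (4 * c)) := by
      gcongr ?_ * Real.exp ?_
      have : r - c * r ^ 2 ≤ 1 / (4 * c) := by
        rw [le_div_iff₀ (by positivity)]
        nlinarith [sq_nonneg (2 * c * r - 1)]
      linarith

/-- Since `exp x = exp w * exp (x - w)`, all derivatives at `w` are those at `0` scaled by `exp w`.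
-/
theorem norm_iteratedFDeriv_cexp (i : ℕ) (w : ℂ) :
    ‖iteratedFDeriv ℝ i Complex.exp w‖ = Real.exp w.re * ‖iteratedFDeriv ℝ i Complex.exp 0‖ := by
  have h : Complex.exp = fun x => Complex.exp w • Complex.exp (x - w) := by
    ext x
    rw [smul_eq_mul, ← Complex.exp_add]
    ring_nf
  conv_lhs => rw [h]
  have hs : ContDiffAt ℝ i (fun x : ℂ => Complex.exp (x - w)) w := by fun_prop
  rw [iteratedFDeriv_const_smul_apply' (a := Complex.exp w) hs, norm_smul, Complex.norm_exp,
    iteratedFDeriv_comp_sub, sub_self]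

/-- The derivatives of the quadratic exponent grow polynomially, so by the Faà di Bruno bound each
derivative of the Gaussian is at most a polynomial times the Gaussian, which absorbs the polynomial.
-/
theorem gaussian_decay {b : ℂ} (hb : 0 < b.re) (x : V) (k m : ℕ) :
    ∃ C : ℝ, ∀ y : V, ‖y‖ ^ k *
      ‖iteratedFDeriv ℝ m (fun y => Complex.exp (-b * (‖x - y‖ ^ 2 : ℝ))) y‖ ≤ C := by
  have hg : (fun y : V => -b * ((‖x - y‖ ^ 2 : ℝ) : ℂ)).HasTemperateGrowth := by
    have h1 : (fun y : V => x - y).HasTemperateGrowth := by fun_prop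
    have h2 := Function.hasTemperateGrowth_norm_sq (H := V)
    have h3 := Function.Complex.hasTemperateGrowth_ofReal.comp (h2.comp h1)
    exact (Function.HasTemperateGrowth.const (-b)).mul h3
  obtain ⟨N, C, hC, hN⟩ := hg.norm_iteratedFDeriv_le_uniform m
  set A : ℝ := ∑ i ∈ Finset.range (m + 1), ‖iteratedFDeriv ℝ i Complex.exp 0‖ with hA
  have hA0 : 0 ≤ A := Finset.sum_nonneg fun i _ => norm_nonneg _
  set K := k + N * m
  refine ⟨m.factorial * A * (C + 1) ^ m * (1 + ‖x‖) ^ K *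
    (K.factorial * Real.exp (1 + 1 / (4 * b.re))), fun y => ?_⟩
  have hre : (-b * ((‖x - y‖ ^ 2 : ℝ) : ℂ)).re = -b.re * ‖x - y‖ ^ 2 := by
    rw [Complex.re_mul_ofReal, Complex.neg_re]
  have h1 := norm_iteratedFDeriv_comp_le (𝕜 := ℝ) (g := Complex.exp)
    (f := fun y : V => -b * ((‖x - y‖ ^ 2 : ℝ) : ℂ)) (n := m) (N := m)
    (by fun_prop) (hg.1.of_le (by exact_mod_cast le_top)) le_rfl y
    -- Taking `C + 1` instead of `C` makes `D ≥ 1`, so that a bound by `D` is also one by `D ^ i`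
    -- for `i ≥ 1`.
    (C := Real.exp (-b.re * ‖x - y‖ ^ 2) * A) (D := (C + 1) * (1 + ‖y‖) ^ N)
    (fun i hi => by
      rw [norm_iteratedFDeriv_cexp, hre]
      gcongr
      exact Finset.single_le_sum (f := fun i => ‖iteratedFDeriv ℝ i Complex.exp 0‖)
        (fun i _ => norm_nonneg _) (Finset.mem_range.2 (by omega)))
    (fun i hi1 hi => by
      have h1 : 1 ≤ (1 + ‖y‖) ^ N := one_le_pow₀ (by linarith [norm_nonneg y])
      calc _ ≤ C * (1 + ‖y‖) ^ N := hN i hi y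
        _ ≤ (C + 1) * (1 + ‖y‖) ^ N := by gcongr; linarith
        _ ≤ _ := le_self_pow₀ (by nlinarith) (by omega))
  -- Polynomial growth in `y` is moved to the centre of the Gaussian, at the price of a factor
  -- depending on `x` only.
  have hxy : 1 + ‖y‖ ≤ (1 + ‖x‖) * (1 + ‖x - y‖) := by
    have : ‖y‖ ≤ ‖x‖ + ‖x - y‖ := by
      have := norm_sub_le x (x - y)
      rwa [sub_sub_cancel] at this
    nlinarith [norm_nonneg x, norm_nonneg (x - y)]
  calc _ ≤ (1 + ‖y‖) ^ k * (m.factorial * (Real.exp (-b.re * ‖x - y‖ ^ 2) * A) *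
        ((C + 1) * (1 + ‖y‖) ^ N) ^ m) := by
        gcongr
        · linarith
        · exact h1
    _ = m.factorial * A * (C + 1) ^ m * (1 + ‖y‖) ^ K * Real.exp (-b.re * ‖x - y‖ ^ 2) := by
      rw [mul_pow, ← pow_mul, pow_add]; ring
    _ ≤ m.factorial * A * (C + 1) ^ m * ((1 + ‖x‖) * (1 + ‖x - y‖)) ^ K *
        Real.exp (-b.re * ‖x - y‖ ^ 2) := by gcongr
    _ = m.factorial * A * (C + 1) ^ m * (1 + ‖x‖) ^ K * ((1 + ‖x - y‖) ^ K *
        Real.exp (-b.re * ‖x - y‖ ^ 2)) := by rw [mul_pow]; ring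
    _ ≤ _ := mul_le_mul_of_nonneg_left
      (one_add_pow_mul_exp_neg_mul_sq_le hb K (norm_nonneg (x - y))) (by positivity)

/-- The Schwartz function `y ↦ exp (-b * ‖x - y‖ ^ 2)`. -/
noncomputable def gaussianSchwartz (b : ℂ) (hb : 0 < b.re) (x : V) : 𝓢(V, ℂ) where
  toFun y := Complex.exp (-b * (‖x - y‖ ^ 2 : ℝ))
  smooth' := by
    have : ContDiff ℝ (⊤ : ℕ∞) (fun y : V => (‖x - y‖ ^ 2 : ℝ)) :=
      (contDiff_const.sub contDiff_id).norm_sq ℝ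
    exact (contDiff_const.mul (Complex.ofRealCLM.contDiff.comp this)).cexp
  decay' k m := gaussian_decay hb x k m

theorem gaussianSchwartz_apply (b : ℂ) (hb : 0 < b.re) (x y : V) :
    gaussianSchwartz b hb x y = Complex.exp (-b * (‖x - y‖ ^ 2 : ℝ)) := rfl

theorem hasDerivAt_gaussian_line (b : ℂ) (x y m : V) (t : ℝ) :
    HasDerivAt (fun t : ℝ => Complex.exp (-b * (‖x - (y + t • m)‖ ^ 2 : ℝ)))
      (2 * b * (inner ℝ (x - (y + t • m)) m : ℝ) *
        Complex.exp (-b * (‖x - (y + t • m)‖ ^ 2 : ℝ))) t := by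
  have h0 : HasDerivAt (fun t : ℝ => x - (y + t • m)) (-m) t := by
    simpa using (((hasDerivAt_id t).smul_const m).const_add y).const_sub x
  have h1 := (h0.norm_sq.ofReal_comp.const_mul (-b)).cexp
  convert h1 using 1
  push_cast
  rw [inner_neg_right]
  push_cast
  ring

open LineDeriv in
theorem lineDerivOp_gaussianSchwartz (b : ℂ) (hb : 0 < b.re) (x y m : V) :
    ∂_{m} (gaussianSchwartz b hb x) y =
      2 * b * (inner ℝ (x - y) m : ℝ) * Complex.exp (-b * (‖x - y‖ ^ 2 : ℝ)) := by
  rw [SchwartzMap.lineDerivOp_apply]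
  have := (hasDerivAt_gaussian_line b x y m 0).deriv
  simpa [lineDeriv, gaussianSchwartz_apply] using this

open LineDeriv in
theorem lineDerivOp_lineDerivOp_gaussianSchwartz (b : ℂ) (hb : 0 < b.re) (x y m : V) :
    ∂_{m} (∂_{m} (gaussianSchwartz b hb x)) y =
      (4 * b ^ 2 * ((inner ℝ (x - y) m) ^ 2 : ℝ) - 2 * b * (‖m‖ ^ 2 : ℝ)) *
        Complex.exp (-b * (‖x - y‖ ^ 2 : ℝ)) := by
  rw [SchwartzMap.lineDerivOp_apply]
  have h : HasDerivAt (fun t : ℝ => ∂_{m} (gaussianSchwartz b hb x) (y + t • m))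
      ((4 * b ^ 2 * ((inner ℝ (x - y) m) ^ 2 : ℝ) - 2 * b * (‖m‖ ^ 2 : ℝ)) *
        Complex.exp (-b * (‖x - y‖ ^ 2 : ℝ))) 0 := by
    rw [funext fun t : ℝ => lineDerivOp_gaussianSchwartz b hb x (y + t • m) m]
    have h0 : HasDerivAt (fun t : ℝ => x - (y + t • m)) (-m) 0 := by
      simpa using (((hasDerivAt_id (0 : ℝ)).smul_const m).const_add y).const_sub x
    have h1 := ((h0.inner ℝ (hasDerivAt_const (0 : ℝ) m)).ofReal_comp.const_mul (2 * b)).mul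
      (hasDerivAt_gaussian_line b x y m 0)
    refine h1.congr_deriv ?_
    simp only [zero_smul, add_zero, inner_zero_right, inner_neg_left, zero_add,
      real_inner_self_eq_norm_sq]
    push_cast
    ring
  exact h.deriv

open scoped Laplacian in
theorem laplacian_gaussianSchwartz [FiniteDimensional ℝ V] (b : ℂ) (hb : 0 < b.re) (x y : V) :
    (Δ (gaussianSchwartz b hb x)) y =
      (4 * b ^ 2 * (‖x - y‖ ^ 2 : ℝ) - 2 * b * Module.finrank ℝ V) *
        Complex.exp (-b * (‖x - y‖ ^ 2 : ℝ)) := by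
  rw [SchwartzMap.laplacian_eq_sum (stdOrthonormalBasis ℝ V), _root_.sum_apply]
  simp only [lineDerivOp_lineDerivOp_gaussianSchwartz]
  rw [← Finset.sum_mul, Finset.sum_sub_distrib, ← Finset.mul_sum, ← Finset.mul_sum]
  have h := (stdOrthonormalBasis ℝ V).sum_sq_norm_inner_left (x - y)
  simp only [Real.norm_eq_abs, sq_abs] at h
  rw [← Complex.ofReal_sum, h]
  simp

end Gaussian

/-! ### Holomorphic dependence of integrals on a parameter -/

section HolomorphicIntegral

/-- For holomorphic integrands, Cauchy's estimate turns a dominating function for `F` into one for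
its derivative, so no separate bound on `F'` is needed. -/
theorem integrable_and_hasDerivAt_integral_of_norm_le {α : Type*} [MeasurableSpace α] {μ : Measure α}
    {F F' : ℂ → α → ℂ} {z₀ : ℂ} {r : ℝ} (hr : 0 < r) {bound : α → ℝ}
    (hF : ∀ z ∈ Metric.ball z₀ r, AEStronglyMeasurable (F z) μ)
    (hF' : AEStronglyMeasurable (F' z₀) μ) (hbound : Integrable bound μ)
    (hle : ∀ᵐ a ∂μ, ∀ z ∈ Metric.ball z₀ r, ‖F z a‖ ≤ bound a)
    (hd : ∀ᵐ a ∂μ, ∀ z ∈ Metric.ball z₀ r, HasDerivAt (F · a) (F' z a) z) :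
    Integrable (F' z₀) μ ∧ HasDerivAt (fun z => ∫ a, F z a ∂μ) (∫ a, F' z₀ a ∂μ) z₀ := by
  have h0 : z₀ ∈ Metric.ball z₀ r := Metric.mem_ball_self hr
  refine hasDerivAt_integral_of_dominated_loc_of_deriv_le
    (Metric.ball_mem_nhds z₀ (half_pos hr)) ?_ ?_ hF'
    (bound := fun a => bound a / (r / 3)) ?_ (hbound.div_const _) ?_
  · filter_upwards [Metric.ball_mem_nhds z₀ hr] with z hz using hF z hz
  · exact hbound.mono' (hF _ h0) (hle.mono fun a ha => ha _ h0)
  · filter_upwards [hle, hd] with a ha1 ha2 z hz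
    -- Here `z` is within `r / 2` of `z₀`, and `r / 2 + r / 3 < r`.
    have hsub : Metric.closedBall z (r / 3) ⊆ Metric.ball z₀ r := by
      intro w hw
      rw [Metric.mem_closedBall] at hw
      rw [Metric.mem_ball] at hz ⊢
      linarith [dist_triangle w z z₀]
    have hz' := hsub (Metric.mem_closedBall_self (by positivity))
    rw [← (ha2 z hz').deriv]
    refine Complex.norm_deriv_le_of_forall_mem_sphere_norm_le (by positivity) ?_
      fun w hw => ha1 w (hsub (Metric.sphere_subset_closedBall hw))
    refine DifferentiableOn.diffContOnCl fun w hw => ?_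
    exact (ha2 w (hsub (Metric.closure_ball_subset_closedBall hw))).differentiableAt.differentiableWithinAt
  · filter_upwards [hd] with a ha z hz
    exact ha z (Metric.ball_subset_ball (by linarith) hz)

end HolomorphicIntegral

/-! ### The heat kernel at complex time -/

section HeatKernel

open Module

variable {V : Type*} [NormedAddCommGroup V] [InnerProductSpace ℝ V]

/-- The kernel of the operator `exp (ζ * Δ)`, for `0 < ζ.re`. -/
noncomputable def heatKernel (ζ : ℂ) (x : V) : ℂ :=
  (4 * Real.pi * ζ) ^ ((-(finrank ℝ V / 2 : ℝ) : ℝ) : ℂ) * Complex.exp (-(4 * ζ)⁻¹ * (‖x‖ ^ 2 : ℝ))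

theorem re_inv_four_mul_pos {ζ : ℂ} (hζ : 0 < ζ.re) : 0 < ((4 * ζ)⁻¹).re := by
  rw [Complex.inv_re]
  have h4 : (4 * ζ).re = 4 * ζ.re := by simp
  have h0 : 4 * ζ ≠ 0 := fun h => by rw [h] at h4; simp at h4; linarith
  rw [h4]
  have := Complex.normSq_pos.2 h0
  positivity

theorem norm_heatKernel (ζ : ℂ) (x : V) :
    ‖heatKernel ζ x‖ = (4 * Real.pi * ‖ζ‖) ^ (-(finrank ℝ V / 2 : ℝ)) *
      Real.exp (-((4 * ζ)⁻¹).re * ‖x‖ ^ 2) := by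
  rw [heatKernel, norm_mul, Complex.norm_cpow_real, Complex.norm_exp, Complex.re_mul_ofReal,
    Complex.neg_re, norm_mul, norm_mul, Complex.norm_real, Real.norm_of_nonneg Real.pi_pos.le]
  simp

theorem norm_heatKernel_le {ζ : ℂ} (hζ : 0 < ζ.re) (x : V) :
    ‖heatKernel ζ x‖ ≤ (4 * Real.pi * ‖ζ‖) ^ (-(finrank ℝ V / 2 : ℝ)) := by
  rw [norm_heatKernel]
  refine mul_le_of_le_one_right (by positivity) (Real.exp_le_one_iff.2 ?_)
  have := re_inv_four_mul_pos hζ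
  nlinarith [sq_nonneg ‖x‖]

theorem continuous_heatKernel (ζ : ℂ) : Continuous (heatKernel ζ : V → ℂ) := by
  unfold heatKernel
  fun_prop

theorem heatKernel_neg (ζ : ℂ) (x : V) : heatKernel ζ (-x) = heatKernel ζ x := by
  simp [heatKernel]

theorem hasDerivAt_heatKernel {ζ : ℂ} (hζ : 0 < ζ.re) (x : V) :
    HasDerivAt (fun ζ => heatKernel ζ x)
      ((4 * ((4 * ζ)⁻¹) ^ 2 * (‖x‖ ^ 2 : ℝ) - 2 * (4 * ζ)⁻¹ * finrank ℝ V) * heatKernel ζ x) ζ := by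
  have hζ0 : ζ ≠ 0 := fun h => by simp [h] at hζ
  have hs : 4 * (Real.pi : ℂ) * ζ ∈ slitPlane := by
    refine Or.inl ?_
    have : 4 * (Real.pi : ℂ) = ((4 * Real.pi : ℝ) : ℂ) := by push_cast; ring
    rw [this, Complex.re_ofReal_mul]
    positivity
  have h1 : HasDerivAt (fun ζ : ℂ => 4 * (Real.pi : ℂ) * ζ) (4 * Real.pi) ζ := by
    simpa using (hasDerivAt_id ζ).const_mul (4 * (Real.pi : ℂ))
  have h2 := h1.cpow_const (c := ((-(finrank ℝ V / 2 : ℝ) : ℝ) : ℂ)) hs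
  have h3 : HasDerivAt (fun ζ : ℂ => 4 * ζ) 4 ζ := by
    simpa using (hasDerivAt_id ζ).const_mul 4
  have h4 := ((h3.fun_inv (by simpa using hζ0)).neg.mul_const ((‖x‖ ^ 2 : ℝ) : ℂ)).cexp
  have h5 := h2.mul h4
  refine h5.congr_deriv ?_
  have hp : (Real.pi : ℂ) ≠ 0 := by exact_mod_cast Real.pi_ne_zero
  have hne : 4 * (Real.pi : ℂ) * ζ ≠ 0 := by simp [hp, hζ0]
  rw [Complex.cpow_sub _ _ hne, Complex.cpow_one, heatKernel]
  simp only [Pi.neg_apply]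
  push_cast
  field_simp
  ring

/-- A single Gaussian dominates the kernels for all `ζ` near `ζ₀`, by continuity of the width and of
the prefactor; this is the domination needed to differentiate in `ζ`. -/
theorem exists_norm_heatKernel_le {ζ₀ : ℂ} (hζ₀ : 0 < ζ₀.re) :
    ∃ r > 0, ∃ C c : ℝ, 0 < c ∧ ∀ ζ ∈ Metric.ball ζ₀ r, 0 < ζ.re ∧
      ∀ x : V, ‖heatKernel ζ x‖ ≤ C * Real.exp (-c * ‖x‖ ^ 2) := by
  have hb := re_inv_four_mul_pos hζ₀
  have hζ0 : ζ₀ ≠ 0 := fun h => by simp [h] at hζ₀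
  have h1 : ∀ᶠ ζ in 𝓝 ζ₀, 0 < ζ.re :=
    (Complex.continuous_re.tendsto ζ₀).eventually (lt_mem_nhds hζ₀)
  have h2 : ∀ᶠ ζ in 𝓝 ζ₀, ((4 * ζ₀)⁻¹).re / 2 < ((4 * ζ)⁻¹).re := by
    have : ContinuousAt (fun ζ : ℂ => ((4 * ζ)⁻¹).re) ζ₀ :=
      Complex.continuous_re.continuousAt.comp
        (ContinuousAt.inv₀ (by fun_prop) (by simpa using hζ0))
    exact this.eventually (lt_mem_nhds (by linarith))
  have h3 : ∀ᶠ ζ in 𝓝 ζ₀, (4 * Real.pi * ‖ζ‖) ^ (-(finrank ℝ V / 2 : ℝ)) <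
      (4 * Real.pi * ‖ζ₀‖) ^ (-(finrank ℝ V / 2 : ℝ)) + 1 := by
    have : ContinuousAt (fun ζ : ℂ => (4 * Real.pi * ‖ζ‖) ^ (-(finrank ℝ V / 2 : ℝ))) ζ₀ := by
      refine ContinuousAt.rpow_const (by fun_prop) (Or.inl ?_)
      have := norm_pos_iff.2 hζ0
      positivity
    exact this.eventually (gt_mem_nhds (by linarith))
  obtain ⟨r, hr, h⟩ := Metric.eventually_nhds_iff_ball.1 (h1.and (h2.and h3))
  refine ⟨r, hr, (4 * Real.pi * ‖ζ₀‖) ^ (-(finrank ℝ V / 2 : ℝ)) + 1, ((4 * ζ₀)⁻¹).re / 2,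
    half_pos hb, fun ζ hζ => ⟨(h ζ hζ).1, fun x => ?_⟩⟩
  obtain ⟨-, h5, h6⟩ := h ζ hζ
  rw [norm_heatKernel]
  gcongr

theorem exists_norm_heatKernel_le_gaussian {ζ : ℂ} (hζ : 0 < ζ.re) :
    ∃ C c : ℝ, 0 < c ∧ ∀ x : V, ‖heatKernel ζ x‖ ≤ C * Real.exp (-c * ‖x‖ ^ 2) :=
  ⟨_, _, re_inv_four_mul_pos hζ, fun x => (norm_heatKernel ζ x).le⟩

theorem heatKernel_sub_eq_gaussianSchwartz {ζ : ℂ} (hζ : 0 < ζ.re) (x y : V) :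
    heatKernel ζ (x - y) = ((4 * Real.pi * ζ) ^ ((-(finrank ℝ V / 2 : ℝ) : ℝ) : ℂ) •
      gaussianSchwartz (4 * ζ)⁻¹ (re_inv_four_mul_pos hζ) x) y := rfl

theorem heatKernel_ofReal {t : ℝ} (ht : 0 < t) (x : V) :
    heatKernel (t : ℂ) x = ((4 * Real.pi * t) ^ (-(finrank ℝ V / 2 : ℝ)) *
      Real.exp (-(1 / (4 * t)) * ‖x‖ ^ 2) : ℝ) := by
  rw [heatKernel, Complex.ofReal_mul, Complex.ofReal_cpow (by positivity)]
  push_cast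
  simp [mul_comm]

variable [FiniteDimensional ℝ V]

theorem heatKernel_laplacian {ζ : ℂ} (hζ : 0 < ζ.re) (x y : V) :
    (Δ ((4 * Real.pi * ζ) ^ ((-(finrank ℝ V / 2 : ℝ) : ℝ) : ℂ) •
      gaussianSchwartz (4 * ζ)⁻¹ (re_inv_four_mul_pos hζ) x)) y =
    (4 * ((4 * ζ)⁻¹) ^ 2 * (‖x - y‖ ^ 2 : ℝ) - 2 * (4 * ζ)⁻¹ * finrank ℝ V) *
      heatKernel ζ (x - y) := by
  rw [← SchwartzMap.laplacianCLM_eq ℂ, map_smul, SchwartzMap.laplacianCLM_eq, _root_.smul_apply,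
    laplacian_gaussianSchwartz, heatKernel, smul_eq_mul]
  ring

variable [MeasurableSpace V] [BorelSpace V]

theorem integrable_exp_neg_mul_norm_sq {c : ℝ} (hc : 0 < c) :
    Integrable (fun x : V => Real.exp (-c * ‖x‖ ^ 2)) := by
  have h := GaussianFourier.integrable_cexp_neg_mul_sq_norm_add (V := V) (b := c)
    (by simpa using hc) 0 0
  refine h.norm.congr (ae_of_all _ fun x => ?_)
  simp only [Complex.norm_exp, zero_mul, add_zero]
  rw [← Complex.ofReal_pow, ← Complex.ofReal_neg, ← Complex.ofReal_mul, Complex.ofReal_re]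

/-- The hypothesis on `u` covers both `L₂` functions and `q u`. The summand `1` is integrated
against the Gaussian decay of `k`, the summand `r` against its boundedness. -/
theorem integrable_convolution_pairing {φ u k : V → ℂ} {r : V → ℝ} {C c : ℝ} (hc : 0 < c)
    (hφ : Integrable φ) (hu : AEStronglyMeasurable u) (hr : Integrable r)
    (hur : ∀ᵐ y, ‖u y‖ ≤ 1 + r y) (hk : Continuous k)
    (hkC : ∀ x, ‖k x‖ ≤ C * Real.exp (-c * ‖x‖ ^ 2)) :
    Integrable (fun p : V × V => φ p.1 * k (p.1 - p.2) * u p.2) (volume.prod volume) := by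
  have hC : 0 ≤ C := by
    have := (norm_nonneg _).trans (hkC 0)
    simpa using this
  have h1 : Integrable (fun p : V × V => ‖φ p.1‖ * Real.exp (-c * ‖p.1 - p.2‖ ^ 2))
      (volume.prod volume) := by
    have := ((hφ.norm.convolution_integrand (ContinuousLinearMap.mul ℝ ℝ)
      (integrable_exp_neg_mul_norm_sq (V := V) hc) (μ := volume) (ν := volume))).swap
    refine this.congr (ae_of_all _ fun p => ?_)
    simp [norm_sub_rev p.2 p.1]
  have h2 := hφ.norm.mul_prod hr.norm (μ := volume) (ν := volume)
  refine ((h1.add h2).const_mul C).mono' ?_ ?_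
  · refine (hφ.aestronglyMeasurable.comp_fst.mul ?_).mul hu.comp_snd
    exact (hk.comp (continuous_fst.sub continuous_snd)).aestronglyMeasurable
  · have := (Measure.quasiMeasurePreserving_snd (μ := (volume : Measure V))
      (ν := (volume : Measure V))).ae hur
    filter_upwards [this] with p hp
    have he : Real.exp (-c * ‖p.1 - p.2‖ ^ 2) ≤ 1 := Real.exp_le_one_iff.2 (by
      nlinarith [sq_nonneg ‖p.1 - p.2‖])
    rw [norm_mul, norm_mul]
    calc ‖φ p.1‖ * ‖k (p.1 - p.2)‖ * ‖u p.2‖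
        ≤ ‖φ p.1‖ * (C * Real.exp (-c * ‖p.1 - p.2‖ ^ 2)) * (1 + ‖r p.2‖) := by
          gcongr
          · exact hkC _
          · exact hp.trans (by gcongr; exact Real.le_norm_self _)
      _ = C * (‖φ p.1‖ * Real.exp (-c * ‖p.1 - p.2‖ ^ 2) +
            Real.exp (-c * ‖p.1 - p.2‖ ^ 2) * (‖φ p.1‖ * ‖r p.2‖)) := by ring
      _ ≤ C * (‖φ p.1‖ * Real.exp (-c * ‖p.1 - p.2‖ ^ 2) + 1 * (‖φ p.1‖ * ‖r p.2‖)) := by gcongr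
      _ = _ := by simp

theorem norm_le_one_add_sq (a : ℂ) : ‖a‖ ≤ 1 + ‖a‖ ^ 2 := by nlinarith [sq_nonneg (‖a‖ - 1)]

theorem integrable_heatKernel {ζ : ℂ} (hζ : 0 < ζ.re) : Integrable (heatKernel ζ : V → ℂ) := by
  refine ((integrable_exp_neg_mul_norm_sq (re_inv_four_mul_pos hζ)).const_mul _).mono'
    (continuous_heatKernel ζ).aestronglyMeasurable (ae_of_all _ fun x => (norm_heatKernel ζ x).le)

theorem integral_heatKernel_ofReal {t : ℝ} (ht : 0 < t) :
    ∫ x : V, heatKernel (t : ℂ) x = 1 := by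
  simp only [heatKernel_ofReal ht]
  rw [integral_complex_ofReal, integral_const_mul,
    GaussianFourier.integral_rexp_neg_mul_sq_norm (by positivity), Real.rpow_neg (by positivity)]
  have : Real.pi / (1 / (4 * t)) = 4 * Real.pi * t := by field_simp
  rw [this, inv_mul_cancel₀ (by positivity), Complex.ofReal_one]

theorem heatKernel_eq_integral {ζ : ℂ} (hζ : 0 < ζ.re) (x : V) :
    heatKernel ζ x = ∫ ξ : V, Complex.exp ((-2 * Real.pi * inner ℝ ξ x : ℝ) * I) *
      Complex.exp (-(4 * Real.pi ^ 2 * ζ) * ‖ξ‖ ^ 2) := by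
  have hp : (Real.pi : ℂ) ≠ 0 := by exact_mod_cast Real.pi_ne_zero
  have hζ0 : ζ ≠ 0 := fun h => by simp [h] at hζ
  have hr : 4 * (Real.pi : ℂ) ^ 2 = ((4 * Real.pi ^ 2 : ℝ) : ℂ) := by push_cast; ring
  have hr' : 4 * (Real.pi : ℂ) = ((4 * Real.pi : ℝ) : ℂ) := by push_cast; ring
  have hb : 0 < (4 * (Real.pi : ℂ) ^ 2 * ζ).re := by
    rw [hr, Complex.re_ofReal_mul]; positivity
  have h := fourier_gaussian_innerProductSpace hb x
  rw [Real.fourier_eq'] at h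
  simp only [smul_eq_mul] at h
  rw [h, heatKernel]
  congr 1
  · have h1 : (Real.pi : ℂ) / (4 * Real.pi ^ 2 * ζ) = (4 * Real.pi * ζ)⁻¹ := by field_simp
    rw [h1, Complex.inv_cpow, Complex.ofReal_neg, Complex.cpow_neg]
    · push_cast; rfl
    · refine (Complex.mem_slitPlane_iff_arg.1 (Or.inl ?_)).1
      rw [hr', Complex.re_ofReal_mul]
      positivity
  · congr 1
    push_cast
    field_simp

end HeatKernel

/-! ### The heat pairing and its bound on L₂ -/

section Pairing

open FourierTransform

variable {V : Type*} [NormedAddCommGroup V] [InnerProductSpace ℝ V] [FiniteDimensional ℝ V]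
  [MeasurableSpace V] [BorelSpace V]

/-- The bilinear pairing `∫∫ f x * heatKernel ζ (x - y) * g y`. -/
noncomputable def heatPairing (ζ : ℂ) (f g : V → ℂ) : ℂ :=
  ∫ p : V × V, f p.1 * heatKernel ζ (p.1 - p.2) * g p.2 ∂(volume.prod volume)

theorem integrable_heatPairing {ζ : ℂ} (hζ : 0 < ζ.re) {f g : V → ℂ} {r : V → ℝ}
    (hf : Integrable f) (hg : AEStronglyMeasurable g) (hr : Integrable r)
    (hgr : ∀ᵐ y, ‖g y‖ ≤ 1 + r y) :
    Integrable (fun p : V × V => f p.1 * heatKernel ζ (p.1 - p.2) * g p.2)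
      (volume.prod volume) := by
  obtain ⟨C, c, hc, h⟩ := exists_norm_heatKernel_le_gaussian (V := V) hζ
  exact integrable_convolution_pairing hc hf hg hr hgr (continuous_heatKernel ζ) h

theorem integrable_heatPairing_of_integrable {ζ : ℂ} (hζ : 0 < ζ.re) {f g : V → ℂ}
    (hf : Integrable f) (hg : Integrable g) :
    Integrable (fun p : V × V => f p.1 * heatKernel ζ (p.1 - p.2) * g p.2)
      (volume.prod volume) :=
  integrable_heatPairing hζ hf hg.aestronglyMeasurable hg.norm (ae_of_all _ fun x => by linarith)

theorem integrable_heatPairing_of_memLp {ζ : ℂ} (hζ : 0 < ζ.re) {f g : V → ℂ}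
    (hf : Integrable f) (hg : MemLp g 2) :
    Integrable (fun p : V × V => f p.1 * heatKernel ζ (p.1 - p.2) * g p.2)
      (volume.prod volume) :=
  integrable_heatPairing hζ hf hg.aestronglyMeasurable (hg.integrable_norm_pow two_ne_zero)
    (ae_of_all _ fun _ => norm_le_one_add_sq _)

theorem integrable_cexp_neg_mul_norm_sq {ζ : ℂ} (hζ : 0 < ζ.re) :
    Integrable (fun ξ : V => Complex.exp (-(4 * Real.pi ^ 2 * ζ) * ‖ξ‖ ^ 2)) := by
  have hr : 4 * (Real.pi : ℂ) ^ 2 = ((4 * Real.pi ^ 2 : ℝ) : ℂ) := by push_cast; ring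
  have := GaussianFourier.integrable_cexp_neg_mul_sq_norm_add (V := V)
    (b := 4 * Real.pi ^ 2 * ζ) (by rw [hr, Complex.re_ofReal_mul]; positivity) 0 0
  simpa using this

/-- Inserting the Fourier representation of the kernel and applying Fubini splits the phase between
the two variables. The pairing is bilinear, so one factor becomes an inverse transform. -/
theorem heatPairing_eq_integral_fourier {ζ : ℂ} (hζ : 0 < ζ.re) {f g : V → ℂ}
    (hf : Integrable f) (hg : Integrable g) :
    heatPairing ζ f g =
      ∫ ξ : V, Complex.exp (-(4 * Real.pi ^ 2 * ζ) * ‖ξ‖ ^ 2) * (𝓕⁻ f ξ * 𝓕 g ξ) := by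
  set E : V → ℂ := fun ξ => Complex.exp (-(4 * Real.pi ^ 2 * ζ) * ‖ξ‖ ^ 2) with hE
  have hEi : Integrable E := integrable_cexp_neg_mul_norm_sq hζ
  have h1 : ∀ p : V × V, f p.1 * heatKernel ζ (p.1 - p.2) * g p.2 = ∫ ξ : V,
      Complex.exp ((2 * Real.pi * inner ℝ p.1 ξ : ℝ) * Complex.I) *
        Complex.exp ((-2 * Real.pi * inner ℝ p.2 ξ : ℝ) * Complex.I) *
        ((f p.1 * g p.2) * E ξ) := by
    intro p
    rw [← heatKernel_neg, heatKernel_eq_integral hζ, ← integral_const_mul, ← integral_mul_const]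
    refine integral_congr_ae (ae_of_all _ fun ξ => ?_)
    have : Complex.exp ((-2 * Real.pi * inner ℝ ξ (-(p.1 - p.2)) : ℝ) * Complex.I) =
        Complex.exp ((2 * Real.pi * inner ℝ p.1 ξ : ℝ) * Complex.I) *
        Complex.exp ((-2 * Real.pi * inner ℝ p.2 ξ : ℝ) * Complex.I) := by
      rw [← Complex.exp_add, inner_neg_right, inner_sub_right, real_inner_comm ξ, real_inner_comm ξ]
      congr 1
      push_cast
      ring
    simp only [this, hE]
    ring
  have h2 : Integrable (Function.uncurry fun (p : V × V) (ξ : V) =>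
      Complex.exp ((2 * Real.pi * inner ℝ p.1 ξ : ℝ) * Complex.I) *
        Complex.exp ((-2 * Real.pi * inner ℝ p.2 ξ : ℝ) * Complex.I) *
        ((f p.1 * g p.2) * E ξ)) ((volume.prod volume).prod volume) := by
    refine ((hf.mul_prod hg).mul_prod hEi).bdd_mul (c := 1) ?_ (ae_of_all _ fun p => ?_)
    · refine Continuous.aestronglyMeasurable ?_
      fun_prop
    · simp only [norm_mul, Complex.norm_exp_ofReal_mul_I, mul_one, le_refl]
  unfold heatPairing
  simp_rw [h1]
  rw [integral_integral_swap h2]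
  refine integral_congr_ae (ae_of_all _ fun ξ => ?_)
  simp only
  rw [Real.fourierInv_eq', Real.fourier_eq', ← integral_prod_mul, ← integral_const_mul]
  refine integral_congr_ae (ae_of_all _ fun p => ?_)
  simp only [smul_eq_mul]
  ring

/-- Schur's test: at real time the kernel is positive, even and of total mass `1`, and `|f x| |f y|`
is at most the mean of the two squares. -/
theorem norm_heatPairing_ofReal_le {t : ℝ} (ht : 0 < t) {f : V → ℂ}
    (hf2 : MemLp f 2) :
    ‖heatPairing (t : ℂ) (fun x => starRingEnd ℂ (f x)) f‖ ≤ ∫ x, ‖f x‖ ^ 2 := by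
  have htre : 0 < ((t : ℂ)).re := by simpa using ht
  have hk : ∀ x : V, heatKernel (t : ℂ) x = (‖heatKernel (t : ℂ) x‖ : ℂ) := fun x => by
    rw [heatKernel_ofReal ht, Complex.norm_real, Real.norm_of_nonneg (by positivity)]
  have hk1 : ∫ x : V, ‖heatKernel (t : ℂ) x‖ = 1 := by
    have := integral_heatKernel_ofReal (V := V) ht
    rw [integral_congr_ae (ae_of_all _ hk), integral_complex_ofReal] at this
    exact_mod_cast this
  have hki := (integrable_heatKernel (V := V) htre).norm
  have hs := hf2.integrable_norm_pow two_ne_zero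
  have hA : Integrable (fun p : V × V => ‖f p.1‖ ^ 2 * ‖heatKernel (t : ℂ) (p.1 - p.2)‖)
      (volume.prod volume) := by
    have := ((hs.convolution_integrand (ContinuousLinearMap.mul ℝ ℝ)
      hki (μ := volume) (ν := volume))).swap
    refine this.congr (ae_of_all _ fun p => ?_)
    simp only [Function.comp, Prod.fst_swap, Prod.snd_swap, ContinuousLinearMap.mul_apply']
    rw [← neg_sub, heatKernel_neg]
  have hAv : ∫ p : V × V, ‖f p.1‖ ^ 2 * ‖heatKernel (t : ℂ) (p.1 - p.2)‖ ∂(volume.prod volume) =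
      ∫ x, ‖f x‖ ^ 2 := by
    rw [integral_prod _ hA]
    refine integral_congr_ae (ae_of_all _ fun x => ?_)
    simp only
    rw [integral_const_mul, integral_sub_left_eq_self (fun y => ‖heatKernel (t : ℂ) y‖), hk1, mul_one]
  have hB : Integrable (fun p : V × V => ‖f p.2‖ ^ 2 * ‖heatKernel (t : ℂ) (p.1 - p.2)‖)
      (volume.prod volume) := by
    refine hA.swap.congr (ae_of_all _ fun p => ?_)
    simp only [Function.comp, Prod.fst_swap, Prod.snd_swap]
    rw [← neg_sub, heatKernel_neg]
  have hBv : ∫ p : V × V, ‖f p.2‖ ^ 2 * ‖heatKernel (t : ℂ) (p.1 - p.2)‖ ∂(volume.prod volume) =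
      ∫ x, ‖f x‖ ^ 2 := by
    rw [← hAv, ← integral_prod_swap]
    refine integral_congr_ae (ae_of_all _ fun p => ?_)
    simp only [Prod.fst_swap, Prod.snd_swap]
    rw [← neg_sub, heatKernel_neg]
  calc _ ≤ ∫ p : V × V, (‖f p.1‖ ^ 2 * ‖heatKernel (t : ℂ) (p.1 - p.2)‖ +
        ‖f p.2‖ ^ 2 * ‖heatKernel (t : ℂ) (p.1 - p.2)‖) / 2 ∂(volume.prod volume) := by
        refine norm_integral_le_of_norm_le ((hA.add hB).div_const 2) (ae_of_all _ fun p => ?_)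
        simp only [norm_mul, RCLike.norm_conj]
        nlinarith [mul_nonneg (sq_nonneg (‖f p.1‖ - ‖f p.2‖))
          (norm_nonneg (heatKernel (t : ℂ) (p.1 - p.2)))]
    _ = _ := by rw [integral_div, integral_add hA hB, hAv, hBv]; ring

theorem fourierInv_conj (f : V → ℂ) (ξ : V) :
    𝓕⁻ (fun x => starRingEnd ℂ (f x)) ξ = starRingEnd ℂ (𝓕 f ξ) := by
  rw [Real.fourierInv_eq', Real.fourier_eq', ← integral_conj]
  refine integral_congr_ae (ae_of_all _ fun x => ?_)
  simp only [smul_eq_mul, map_mul, ← Complex.exp_conj, Complex.conj_ofReal, Complex.conj_I]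
  congr 2
  push_cast
  ring

theorem continuous_fourier_of_integrable {f : V → ℂ} (hf : Integrable f) : Continuous (𝓕 f) :=
  VectorFourier.fourierIntegral_continuous Real.continuous_fourierChar
    continuous_inner hf

/-- Half of Plancherel, obtained from the heat flow: pairing `f` with its conjugate at time `t`
gives the integral of `|𝓕 f|²` against a Gaussian factor, bounded by Schur's test, and Fatou's lemma
removes the factor as `t → 0`. -/
theorem lintegral_norm_fourier_sq_le {f : V → ℂ} (hf : Integrable f) (hf2 : MemLp f 2) :
    ∫⁻ ξ, ENNReal.ofReal (‖𝓕 f ξ‖ ^ 2) ≤ ENNReal.ofReal (∫ x, ‖f x‖ ^ 2) := by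
  have hcont := continuous_fourier_of_integrable hf
  have hbd : ∀ ξ, ‖𝓕 f ξ‖ ≤ ∫ x, ‖f x‖ := fun ξ => by
    rw [Real.fourier_eq]
    refine (norm_integral_le_integral_norm _).trans (le_of_eq ?_)
    simp
  set t : ℕ → ℝ := fun k => 1 / ((k : ℝ) + 1)
  have ht : ∀ k, 0 < t k := fun k => by positivity
  have htl : Tendsto t atTop (𝓝 0) := tendsto_one_div_add_atTop_nhds_zero_nat
  set G : ℕ → V → ENNReal := fun k ξ =>
    ENNReal.ofReal (Real.exp (-(4 * Real.pi ^ 2 * t k) * ‖ξ‖ ^ 2) * ‖𝓕 f ξ‖ ^ 2)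
  have hG : ∀ k, ∫⁻ ξ, G k ξ ≤ ENNReal.ofReal (∫ x, ‖f x‖ ^ 2) := by
    intro k
    have hint : Integrable (fun ξ : V =>
        Real.exp (-(4 * Real.pi ^ 2 * t k) * ‖ξ‖ ^ 2) * ‖𝓕 f ξ‖ ^ 2) := by
      refine (integrable_exp_neg_mul_norm_sq (by have := ht k; positivity)).mul_bdd
        (c := (∫ x, ‖f x‖) ^ 2) (hcont.norm.pow 2).aestronglyMeasurable
        (ae_of_all _ fun ξ => ?_)
      rw [Real.norm_of_nonneg (by positivity)]
      gcongr
      exact hbd ξ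
    rw [← ofReal_integral_eq_lintegral_ofReal hint (ae_of_all _ fun ξ => by positivity)]
    refine ENNReal.ofReal_le_ofReal (le_trans (le_of_eq ?_) (norm_heatPairing_ofReal_le (ht k) hf2))
    rw [heatPairing_eq_integral_fourier (by simpa using ht k)
      (hf.norm.mono' (Complex.continuous_conj.comp_aestronglyMeasurable hf.aestronglyMeasurable)
        (ae_of_all _ fun x => by simp)) hf]
    rw [← Complex.norm_of_nonneg (integral_nonneg fun ξ => by positivity), ← integral_complex_ofReal]
    congr 1
    refine integral_congr_ae (ae_of_all _ fun ξ => ?_)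
    simp only [fourierInv_conj]
    rw [Complex.conj_mul']
    push_cast
    rfl
  have hlim : ∀ ξ, Tendsto (fun k => G k ξ) atTop (𝓝 (ENNReal.ofReal (‖𝓕 f ξ‖ ^ 2))) := by
    intro ξ
    refine ENNReal.tendsto_ofReal ?_
    have : Continuous fun s : ℝ => Real.exp (-(4 * Real.pi ^ 2 * s) * ‖ξ‖ ^ 2) * ‖𝓕 f ξ‖ ^ 2 := by
      fun_prop
    simpa [Function.comp_def] using (this.tendsto 0).comp htl
  calc ∫⁻ ξ, ENNReal.ofReal (‖𝓕 f ξ‖ ^ 2) = ∫⁻ ξ, liminf (fun k => G k ξ) atTop := by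
        simp_rw [(hlim _).liminf_eq]
    _ ≤ liminf (fun k => ∫⁻ ξ, G k ξ) atTop := by
        refine lintegral_liminf_le fun k => ?_
        refine Measurable.ennreal_ofReal ?_
        exact ((by fun_prop : Continuous fun ξ : V =>
          Real.exp (-(4 * Real.pi ^ 2 * t k) * ‖ξ‖ ^ 2)).mul (hcont.norm.pow 2)).measurable
    _ ≤ _ := by
        refine liminf_le_of_frequently_le' (Frequently.of_forall hG)

theorem integrable_norm_fourier_sq {f : V → ℂ} (hf : Integrable f) (hf2 : MemLp f 2) :
    Integrable (fun ξ => ‖𝓕 f ξ‖ ^ 2) := by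
  refine ⟨((continuous_fourier_of_integrable hf).norm.pow 2).aestronglyMeasurable, ?_⟩
  rw [hasFiniteIntegral_iff_ofReal (ae_of_all _ fun ξ => by positivity)]
  exact (lintegral_norm_fourier_sq_le hf hf2).trans_lt ENNReal.ofReal_lt_top

theorem integral_norm_fourier_sq_le {f : V → ℂ} (hf : Integrable f) (hf2 : MemLp f 2) :
    ∫ ξ, ‖𝓕 f ξ‖ ^ 2 ≤ ∫ x, ‖f x‖ ^ 2 := by
  rw [integral_eq_lintegral_of_nonneg_ae (ae_of_all _ fun ξ => by positivity)
    (integrable_norm_fourier_sq hf hf2).aestronglyMeasurable]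
  exact ENNReal.toReal_le_of_le_ofReal (integral_nonneg fun x => by positivity)
    (lintegral_norm_fourier_sq_le hf hf2)

theorem integral_mul_le_sqrt_mul_sqrt {α : Type*} [MeasurableSpace α] {μ : Measure α}
    {f g : α → ℂ} (hf : MemLp f 2 μ) (hg : MemLp g 2 μ) :
    ∫ x, ‖f x‖ * ‖g x‖ ∂μ ≤ √(∫ x, ‖f x‖ ^ 2 ∂μ) * √(∫ x, ‖g x‖ ^ 2 ∂μ) := by
  have := integral_mul_le_Lp_mul_Lq_of_nonneg (μ := μ) (Real.HolderConjugate.two_two)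
    (f := fun x => ‖f x‖) (g := fun x => ‖g x‖) (ae_of_all _ fun x => norm_nonneg _)
    (ae_of_all _ fun x => norm_nonneg _) (by simpa using hf.norm) (by simpa using hg.norm)
  simpa [Real.sqrt_eq_rpow] using this

/-- On the Fourier side the multiplier has modulus at most `1` because `Re ζ > 0`; Cauchy–Schwarz
and the Plancherel inequality finish. The bound is uniform up to the imaginary axis. -/
theorem norm_heatPairing_le {ζ : ℂ} (hζ : 0 < ζ.re) {f g : V → ℂ} (hf : Integrable f)
    (hf2 : MemLp f 2) (hg : Integrable g) (hg2 : MemLp g 2) :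
    ‖heatPairing ζ f g‖ ≤ √(∫ x, ‖f x‖ ^ 2) * √(∫ x, ‖g x‖ ^ 2) := by
  have memLp : ∀ {h : V → ℂ}, Integrable h → MemLp h 2 → MemLp (𝓕 h) 2 := fun h1 h2 =>
    (memLp_two_iff_integrable_sq_norm
      (continuous_fourier_of_integrable h1).aestronglyMeasurable).2 (integrable_norm_fourier_sq h1 h2)
  have hF := memLp hf hf2
  have hG := memLp hg hg2
  have hF' : MemLp (𝓕⁻ f) 2 := by
    have : 𝓕⁻ f = fun ξ => 𝓕 f (-ξ) := by ext ξ; rw [Real.fourierInv_eq_fourier_neg]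
    rw [this]
    exact hF.comp_measurePreserving (Measure.measurePreserving_neg volume)
  have hFF : ∫ ξ, ‖𝓕⁻ f ξ‖ ^ 2 = ∫ ξ, ‖𝓕 f ξ‖ ^ 2 := by
    simp_rw [Real.fourierInv_eq_fourier_neg]
    exact integral_neg_eq_self (fun ξ => ‖𝓕 f ξ‖ ^ 2) volume
  rw [heatPairing_eq_integral_fourier hζ hf hg]
  have hmul : Integrable (fun ξ => ‖𝓕⁻ f ξ‖ * ‖𝓕 g ξ‖) := hF'.norm.integrable_mul hG.norm
  calc _ ≤ ∫ ξ, ‖𝓕⁻ f ξ‖ * ‖𝓕 g ξ‖ := by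
        refine norm_integral_le_of_norm_le hmul (ae_of_all _ fun ξ => ?_)
        rw [norm_mul, norm_mul, Complex.norm_exp]
        refine mul_le_of_le_one_left (by positivity) (Real.exp_le_one_iff.2 ?_)
        have hr : -(4 * (Real.pi : ℂ) ^ 2 * ζ) * ‖ξ‖ ^ 2 =
          ((-(4 * Real.pi ^ 2 * ‖ξ‖ ^ 2) : ℝ) : ℂ) * ζ := by push_cast; ring
        rw [hr, Complex.re_ofReal_mul]
        have : 0 ≤ 4 * Real.pi ^ 2 * ‖ξ‖ ^ 2 * ζ.re := by positivity
        linarith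
    _ ≤ √(∫ ξ, ‖𝓕⁻ f ξ‖ ^ 2) * √(∫ ξ, ‖𝓕 g ξ‖ ^ 2) := integral_mul_le_sqrt_mul_sqrt hF' hG
    _ ≤ _ := by
        rw [hFF]
        exact mul_le_mul (Real.sqrt_le_sqrt (integral_norm_fourier_sq_le hf hf2))
          (Real.sqrt_le_sqrt (integral_norm_fourier_sq_le hg hg2)) (by positivity) (by positivity)

end Pairing

/-! ### Complex interpolation of the weighted pairing -/

section Interpolation

open Module

variable {V : Type*} [NormedAddCommGroup V] [InnerProductSpace ℝ V] [FiniteDimensional ℝ V]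
  [MeasurableSpace V] [BorelSpace V]

theorem integral_norm_sq_congr_norm {f g : V → ℂ} (h : ∀ x, ‖f x‖ = ‖g x‖) :
    ∫ x, ‖f x‖ ^ 2 = ∫ x, ‖g x‖ ^ 2 := by
  simp_rw [h]

theorem differentiable_integral_mul_cexp {α : Type*} [MeasurableSpace α] {μ : Measure α}
    {G l : α → ℂ} (hG : Integrable G μ) (hl : Measurable l) {B : ℝ} (hB : ∀ a, ‖l a‖ ≤ B) :
    Differentiable ℂ fun ω : ℂ => ∫ a, G a * Complex.exp (ω * l a) ∂μ := by
  intro ω₀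
  refine (integrable_and_hasDerivAt_integral_of_norm_le (F := fun ω a => G a * Complex.exp (ω * l a))
    (F' := fun ω a => G a * (Complex.exp (ω * l a) * l a)) one_pos
    (bound := fun a => ‖G a‖ * Real.exp ((‖ω₀‖ + 1) * B)) (fun ω _ => ?_) ?_ (hG.norm.mul_const _)
    (ae_of_all _ fun a ω hω => ?_) (ae_of_all _ fun a ω _ => ?_)).2.differentiableAt
  · exact hG.aestronglyMeasurable.mul (hl.const_mul ω).cexp.aestronglyMeasurable
  · exact hG.aestronglyMeasurable.mul ((hl.const_mul ω₀).cexp.mul hl).aestronglyMeasurable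
  · rw [norm_mul]
    gcongr
    refine (Complex.norm_exp_le_exp_norm _).trans ?_
    rw [norm_mul]
    gcongr
    · rw [Metric.mem_ball, dist_eq_norm] at hω
      have := norm_sub_norm_le ω ω₀
      linarith
    · exact hB a
  · refine HasDerivAt.const_mul _ ?_
    simpa using ((hasDerivAt_id ω).mul_const (l a)).cexp

/-- Three lines theorem for `ω ↦ heatPairing ζ (k e^{ωL}) (h e^{ωL})`. On `Re ω = 0` the weights are
unimodular and the `L₂` bound applies; on `Re ω = 1` the sup bound of the kernel does. Boundedness
of `L` makes the function entire and bounded on the strip. -/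
theorem norm_heatPairing_exp_le {ζ : ℂ} (hζ : 0 < ζ.re) {k h : V → ℂ} (hk : Integrable k)
    (hk2 : MemLp k 2) (hh : Integrable h) (hh2 : MemLp h 2) {L : V → ℝ} (hL : Measurable L)
    {B : ℝ} (hB : ∀ x, |L x| ≤ B) {θ : ℝ} (hθ0 : 0 ≤ θ) (hθ1 : θ ≤ 1) :
    ‖heatPairing ζ (fun x => k x * Complex.exp (θ * L x)) (fun x => h x * Complex.exp (θ * L x))‖ ≤
      (√(∫ x, ‖k x‖ ^ 2) * √(∫ x, ‖h x‖ ^ 2)) ^ (1 - θ) *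
        ((4 * Real.pi * ‖ζ‖) ^ (-(finrank ℝ V / 2 : ℝ)) *
          ((∫ x, ‖k x‖ * Real.exp (L x)) * ∫ x, ‖h x‖ * Real.exp (L x))) ^ θ := by
  have hLm : ∀ ω : ℂ, Measurable fun x => Complex.exp (ω * L x) := fun ω => by fun_prop
  have hre : ∀ (ω : ℂ) x, ‖Complex.exp (ω * L x)‖ = Real.exp (ω.re * L x) := fun ω x => by
    rw [Complex.norm_exp, Complex.re_mul_ofReal]
  have hbd : ∀ (ω : ℂ) x, ‖Complex.exp (ω * L x)‖ ≤ Real.exp (|ω.re| * B) := fun ω x => by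
    rw [hre]
    refine Real.exp_le_exp.2 ((le_abs_self _).trans ?_)
    rw [abs_mul]
    gcongr
    exact hB x
  have hi : ∀ (ω : ℂ) {f : V → ℂ}, Integrable f → Integrable fun x => f x * Complex.exp (ω * L x) :=
    fun ω f hf => hf.mul_bdd (c := Real.exp (|ω.re| * B)) (hLm ω).aestronglyMeasurable (ae_of_all _ (hbd ω))
  set F : ℂ → ℂ := fun ω =>
    heatPairing ζ (fun x => k x * Complex.exp (ω * L x)) (fun x => h x * Complex.exp (ω * L x)) with hF
  have hG : Integrable (fun p : V × V => k p.1 * heatKernel ζ (p.1 - p.2) * h p.2)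
      (volume.prod volume) := integrable_heatPairing_of_integrable hζ hk hh
  have hFe : ∀ ω, F ω = ∫ p : V × V, k p.1 * heatKernel ζ (p.1 - p.2) * h p.2 *
      Complex.exp (ω * (L p.1 + L p.2)) ∂(volume.prod volume) := by
    intro ω
    refine integral_congr_ae (ae_of_all _ fun p => ?_)
    simp only [mul_add, Complex.exp_add]
    ring
  have hLp : Measurable fun p : V × V => ((L p.1 : ℂ) + L p.2) := by fun_prop
  have hLpn : ∀ p : V × V, ‖((L p.1 : ℂ) + L p.2)‖ ≤ 2 * B := fun p => by
    refine (norm_add_le _ _).trans ?_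
    simp only [Complex.norm_real, Real.norm_eq_abs]
    linarith [hB p.1, hB p.2]
  have hB0 : 0 ≤ B := (abs_nonneg _).trans (hB 0)
  have hexp : ∀ (ω : ℂ) (p : V × V), ‖Complex.exp (ω * (L p.1 + L p.2))‖ ≤
      Real.exp (|ω.re| * (2 * B)) := fun ω p => by
    have : ω * ((L p.1 : ℂ) + L p.2) = ω * ((L p.1 + L p.2 : ℝ) : ℂ) := by push_cast; ring
    rw [this, Complex.norm_exp, Complex.re_mul_ofReal]
    refine Real.exp_le_exp.2 ((le_abs_self _).trans ?_)
    rw [abs_mul]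
    gcongr
    exact (abs_add_le _ _).trans (by linarith [hB p.1, hB p.2])
  have hd : Differentiable ℂ F := by
    rw [show F = _ from funext hFe]
    exact differentiable_integral_mul_cexp hG hLp hLpn
  have key := HadamardThreeLines.norm_le_interp_of_mem_verticalClosedStrip₀₁' F (z := θ)
    (a := √(∫ x, ‖k x‖ ^ 2) * √(∫ x, ‖h x‖ ^ 2))
    (b := (4 * Real.pi * ‖ζ‖) ^ (-(finrank ℝ V / 2 : ℝ)) *
          ((∫ x, ‖k x‖ * Real.exp (L x)) * ∫ x, ‖h x‖ * Real.exp (L x)))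
    (by simpa [HadamardThreeLines.verticalClosedStrip] using ⟨hθ0, hθ1⟩) hd.diffContOnCl ?_ ?_ ?_
  · simpa [hF] using key
  · refine ⟨∫ p : V × V, ‖k p.1 * heatKernel ζ (p.1 - p.2) * h p.2‖ * Real.exp (1 * (2 * B))
      ∂(volume.prod volume), ?_⟩
    rintro _ ⟨ω, hω, rfl⟩
    simp only [HadamardThreeLines.verticalClosedStrip, Set.mem_preimage, Set.mem_Icc] at hω
    simp only [Function.comp]
    rw [hFe]
    refine norm_integral_le_of_norm_le (hG.norm.mul_const _) (ae_of_all _ fun p => ?_)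
    rw [norm_mul]
    gcongr
    refine (hexp ω p).trans ?_
    gcongr
    rw [abs_of_nonneg hω.1]
    exact hω.2
  · intro ω hω
    have hω : ω.re = 0 := hω
    have hn : ∀ (f : V → ℂ) x, ‖f x * Complex.exp (ω * L x)‖ = ‖f x‖ := fun f x => by
      rw [norm_mul, hre, hω]; simp
    have hm : ∀ {f : V → ℂ}, MemLp f 2 → MemLp (fun x => f x * Complex.exp (ω * L x)) 2 := fun hf =>
      hf.of_le (hf.1.mul (hLm ω).aestronglyMeasurable) (ae_of_all _ fun x => (hn _ x).le)
    have := norm_heatPairing_le hζ (hi ω hk) (hm hk2) (hi ω hh) (hm hh2)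
    rwa [integral_norm_sq_congr_norm (hn k), integral_norm_sq_congr_norm (hn h)] at this
  · intro ω hω
    have hω : ω.re = 1 := hω
    have hn : ∀ (f : V → ℂ) x, ‖f x * Complex.exp (ω * L x)‖ = ‖f x‖ * Real.exp (L x) := fun f x => by
      rw [norm_mul, hre, hω, one_mul]
    rw [← integral_prod_mul, ← integral_const_mul]
    refine norm_integral_le_of_norm_le ?_ (ae_of_all _ fun p => ?_)
    · have := (hi ω hk).norm.mul_prod (hi ω hh).norm (μ := volume) (ν := volume)
      simp only [hn] at this
      exact this.const_mul _
    · rw [norm_mul, norm_mul, hn, hn]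
      have := norm_heatKernel_le hζ (p.1 - p.2)
      calc _ = ‖heatKernel ζ (p.1 - p.2)‖ * (‖k p.1‖ * Real.exp (L p.1) *
            (‖h p.2‖ * Real.exp (L p.2))) := by ring
        _ ≤ _ := by gcongr

theorem tendsto_setIntegral_prod_self {A : ℕ → Set V} (hA : ∀ i, MeasurableSet (A i))
    (hmono : Monotone A) {G : V × V → ℂ} (hG : Integrable G (volume.prod volume))
    (hG0 : ∀ p : V × V, p.1 ∉ ⋃ i, A i ∨ p.2 ∉ ⋃ i, A i → G p = 0) :
    Tendsto (fun i => ∫ p in A i ×ˢ A i, G p ∂(volume.prod volume)) atTop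
      (𝓝 (∫ p, G p ∂(volume.prod volume))) := by
  have h := tendsto_setIntegral_of_monotone (μ := (volume : Measure V).prod volume) (f := G)
    (s := fun i => A i ×ˢ A i) (fun i => (hA i).prod (hA i))
    (fun i j hij => Set.prod_mono (hmono hij) (hmono hij)) hG.integrableOn
  rwa [setIntegral_eq_integral_of_forall_compl_eq_zero] at h
  intro p hp
  refine hG0 p ?_
  by_contra! hcon
  obtain ⟨i, hi⟩ := Set.mem_iUnion.1 hcon.1
  obtain ⟨j, hj⟩ := Set.mem_iUnion.1 hcon.2
  exact hp (Set.mem_iUnion.2 ⟨max i j, hmono (le_max_left i j) hi, hmono (le_max_right i j) hj⟩)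

theorem heatPairing_indicator (ζ : ℂ) (f g : V → ℂ) {A : Set V} (hA : MeasurableSet A) :
    heatPairing ζ (A.indicator f) (A.indicator g) =
      ∫ p in A ×ˢ A, f p.1 * heatKernel ζ (p.1 - p.2) * g p.2 ∂(volume.prod volume) := by
  rw [← integral_indicator (hA.prod hA), heatPairing]
  congr 1
  ext p
  by_cases h1 : p.1 ∈ A <;> by_cases h2 : p.2 ∈ A <;> simp [Set.indicator, h1, h2]

theorem sqrt_integral_indicator_le {f : V → ℂ} (hf : MemLp f 2) {A : Set V} :
    √(∫ x, ‖A.indicator f x‖ ^ 2) ≤ √(∫ x, ‖f x‖ ^ 2) := by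
  refine Real.sqrt_le_sqrt (integral_mono_of_nonneg (ae_of_all _ fun x => by positivity)
    (hf.integrable_norm_pow two_ne_zero) (ae_of_all _ fun x => ?_))
  simp only
  gcongr
  exact norm_indicator_le_norm_self f x

theorem MeasureTheory.MemLp.integrable_indicator_two {f : V → ℂ} (hf : MemLp f 2) {A : Set V}
    (hA : MeasurableSet A) (hfin : volume A ≠ ⊤) : Integrable (A.indicator f) := by
  rw [integrable_indicator_iff hA]
  have : IsFiniteMeasure (volume.restrict A) := ⟨by simpa using hfin.lt_top⟩
  exact (hf.restrict A).integrable (by norm_num)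

/-- Truncation to balls makes `g` integrable without increasing its norm, and the truncated pairings
converge. -/
theorem norm_heatPairing_le_of_memLp {ζ : ℂ} (hζ : 0 < ζ.re) {f g : V → ℂ} (hf : Integrable f)
    (hf2 : MemLp f 2) (hg2 : MemLp g 2) :
    ‖heatPairing ζ f g‖ ≤ √(∫ x, ‖f x‖ ^ 2) * √(∫ x, ‖g x‖ ^ 2) := by
  set A : ℕ → Set V := fun i => Metric.closedBall 0 i
  have hA : ∀ i, MeasurableSet (A i) := fun i => Metric.isClosed_closedBall.measurableSet
  have hU : ⋃ i, A i = Set.univ := by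
    ext x
    simp [A]
  have h := tendsto_setIntegral_prod_self hA
    (fun i j hij => Metric.closedBall_subset_closedBall (by exact_mod_cast hij))
    (integrable_heatPairing_of_memLp hζ hf hg2) (by simp [hU])
  refine le_of_tendsto h.norm (Eventually.of_forall fun i => ?_)
  rw [← heatPairing_indicator ζ f g (hA i)]
  refine (norm_heatPairing_le hζ (hf.indicator (hA i)) (hf2.indicator (hA i))
    (hg2.integrable_indicator_two (hA i) (measure_closedBall_lt_top.ne)) (hg2.indicator (hA i))).trans ?_
  exact mul_le_mul (sqrt_integral_indicator_le hf2) (sqrt_integral_indicator_le hg2)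
    (by positivity) (by positivity)

/-- Interpolation with `L = log w`, on sets where `log w` is bounded. Cauchy–Schwarz on the line `Re
ω = 1` brings in `∫ w²`, and the norms of `k` and `h` recombine to the first power. -/
theorem norm_heatPairing_weighted_le {ζ : ℂ} (hζ : 0 < ζ.re) {k h : V → ℂ} (hk : MemLp k 2)
    (hh : MemLp h 2) {w : V → ℝ} (hw : Measurable w) (hw0 : ∀ x, 0 ≤ w x)
    (hw2 : Integrable fun x => w x ^ 2) {θ : ℝ} (hθ0 : 0 < θ) (hθ1 : θ ≤ 1)
    (hint : Integrable (fun p : V × V => (k p.1 * (w p.1 ^ θ : ℝ)) * heatKernel ζ (p.1 - p.2) *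
      (h p.2 * (w p.2 ^ θ : ℝ))) (volume.prod volume)) :
    ‖heatPairing ζ (fun x => k x * (w x ^ θ : ℝ)) (fun x => h x * (w x ^ θ : ℝ))‖ ≤
      ((4 * Real.pi * ‖ζ‖) ^ (-(finrank ℝ V / 2 : ℝ)) * ∫ x, w x ^ 2) ^ θ *
        (√(∫ x, ‖k x‖ ^ 2) * √(∫ x, ‖h x‖ ^ 2)) := by
  -- The ball gives finite volume, and the two bounds on `w` keep `log w` within `log (i + 1)`.
  -- Points in no `A i` have `w = 0` and contribute nothing, since `θ > 0`.
  set A : ℕ → Set V := fun i =>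
    Metric.closedBall 0 i ∩ {x | 1 / ((i : ℝ) + 1) ≤ w x} ∩ {x | w x ≤ i} with hAdef
  have hA : ∀ i, MeasurableSet (A i) := fun i =>
    (Metric.isClosed_closedBall.measurableSet.inter (measurableSet_le measurable_const hw)).inter
      (measurableSet_le hw measurable_const)
  have hAfin : ∀ i, volume (A i) ≠ ⊤ := fun i => ne_top_of_le_ne_top
    (measure_closedBall_lt_top (μ := (volume : Measure V)) (x := (0 : V)) (r := i)).ne
    (measure_mono fun x hx => hx.1.1)
  have hmono : Monotone A := by
    intro i j hij x hx
    have hij' : (i : ℝ) ≤ j := by exact_mod_cast hij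
    have h1 : 1 / ((i : ℝ) + 1) ≤ w x := hx.1.2
    have h2 : w x ≤ i := hx.2
    have h3 : 1 / ((j : ℝ) + 1) ≤ 1 / ((i : ℝ) + 1) := by gcongr
    exact ⟨⟨Metric.closedBall_subset_closedBall hij' hx.1.1, h3.trans h1⟩, h2.trans hij'⟩
  have hU : ∀ x, x ∉ ⋃ i, A i → w x = 0 := by
    intro x hx
    by_contra hne
    have hpos : 0 < w x := lt_of_le_of_ne (hw0 x) (Ne.symm hne)
    obtain ⟨i, hi⟩ := exists_nat_ge (max ‖x‖ (max (w x) (1 / w x)))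
    refine hx (Set.mem_iUnion.2 ⟨i, ⟨⟨?_, ?_⟩, ?_⟩⟩)
    · simpa using (le_max_left _ _).trans hi
    · have h1 : 1 / w x ≤ i := ((le_max_right _ _).trans (le_max_right _ _)).trans hi
      rw [Set.mem_ofPred_eq, div_le_iff₀ (by positivity)]
      rw [div_le_iff₀ hpos] at h1
      nlinarith
    · exact ((le_max_left _ _).trans (le_max_right _ _)).trans hi
  have hlim := tendsto_setIntegral_prod_self hA hmono hint (by
    rintro p (hp | hp) <;> simp [hU _ hp, Real.zero_rpow hθ0.ne'])
  refine le_of_tendsto hlim.norm (Eventually.of_forall fun i => ?_)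
  rw [← heatPairing_indicator ζ (fun x => k x * (w x ^ θ : ℝ)) (fun x => h x * (w x ^ θ : ℝ)) (hA i)]
  set L : V → ℝ := (A i).indicator fun x => Real.log (w x) with hLdef
  have hwpos : ∀ x ∈ A i, 0 < w x := fun x hx => lt_of_lt_of_le (by positivity) hx.1.2
  have hLm : Measurable L := (Real.measurable_log.comp hw).indicator (hA i)
  have hLB : ∀ x, |L x| ≤ Real.log (i + 1) := by
    intro x
    by_cases hx : x ∈ A i
    · simp only [hLdef, Set.indicator_of_mem hx]
      rw [abs_le]
      constructor
      · rw [← Real.log_inv, ← one_div]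
        exact Real.log_le_log (by positivity) hx.1.2
      · have : w x ≤ i := hx.2
        exact Real.log_le_log (hwpos x hx) (by linarith)
    · simp only [hLdef, Set.indicator_of_notMem hx, abs_zero]
      exact Real.log_nonneg (by simp)
  have hind : ∀ f : V → ℂ, (A i).indicator (fun x => f x * (w x ^ θ : ℝ)) =
      fun x => (A i).indicator f x * Complex.exp (θ * L x) := by
    intro f
    ext x
    by_cases hx : x ∈ A i
    · simp only [hLdef, Set.indicator_of_mem hx]
      rw [Real.rpow_def_of_pos (hwpos x hx)]
      push_cast
      ring_nf
    · simp [Set.indicator_of_notMem hx]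
  rw [hind, hind]
  refine (norm_heatPairing_exp_le hζ (hk.integrable_indicator_two (hA i) (hAfin i))
    (hk.indicator (hA i)) (hh.integrable_indicator_two (hA i) (hAfin i)) (hh.indicator (hA i))
    hLm hLB hθ0.le hθ1).trans ?_
  have hwm : MemLp (fun x => (w x : ℂ)) 2 := by
    rw [memLp_two_iff_integrable_sq_norm (by fun_prop)]
    simpa using hw2
  have hl1 : ∀ {f : V → ℂ}, MemLp f 2 → ∫ x, ‖(A i).indicator f x‖ * Real.exp (L x) ≤
      √(∫ x, ‖f x‖ ^ 2) * √(∫ x, w x ^ 2) := by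
    intro f hf
    have hm : Integrable fun x => ‖f x‖ * ‖(w x : ℂ)‖ := hf.norm.integrable_mul hwm.norm
    have hcs := integral_mul_le_sqrt_mul_sqrt hf hwm
    simp only [Complex.norm_real, Real.norm_eq_abs, abs_of_nonneg (hw0 _)] at hcs hm
    refine le_trans (integral_mono_of_nonneg (ae_of_all _ fun x => by positivity) hm
      (ae_of_all _ fun x => ?_)) hcs
    by_cases hx : x ∈ A i
    · simp [hLdef, Set.indicator_of_mem hx, Real.exp_log (hwpos x hx)]
    · simp only [Set.indicator_of_notMem hx, norm_zero, zero_mul]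
      have := hw0 x
      positivity
  set Nk := √(∫ x, ‖k x‖ ^ 2)
  set Nh := √(∫ x, ‖h x‖ ^ 2)
  set W := √(∫ x, w x ^ 2) with hW
  have hWW : W * W = ∫ x, w x ^ 2 :=
    Real.mul_self_sqrt (integral_nonneg fun x => by positivity)
  set K := (4 * Real.pi * ‖ζ‖) ^ (-(finrank ℝ V / 2 : ℝ))
  have hNk : 0 ≤ Nk := Real.sqrt_nonneg _
  have hNh : 0 ≤ Nh := Real.sqrt_nonneg _
  have hW0 : 0 ≤ W := Real.sqrt_nonneg _
  have hK0 : 0 ≤ K := by positivity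
  have hnn : ∀ f : V → ℂ, 0 ≤ ∫ x, ‖(A i).indicator f x‖ * Real.exp (L x) := fun f =>
    integral_nonneg fun x => by positivity
  calc _ ≤ (Nk * Nh) ^ (1 - θ) * (K * ((Nk * W) * (Nh * W))) ^ θ := by
        refine mul_le_mul ?_ ?_ (by have := hnn k; have := hnn h; positivity) (by positivity)
        · exact Real.rpow_le_rpow (by positivity) (mul_le_mul (sqrt_integral_indicator_le hk)
            (sqrt_integral_indicator_le hh) (by positivity) (by positivity)) (by linarith)
        · refine Real.rpow_le_rpow (by have := hnn k; have := hnn h; positivity) ?_ hθ0.le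
          exact mul_le_mul_of_nonneg_left
            (mul_le_mul (hl1 hk) (hl1 hh) (hnn h) (by positivity)) hK0
    _ = (K * ∫ x, w x ^ 2) ^ θ * ((Nk * Nh) ^ (1 - θ) * (Nk * Nh) ^ θ) := by
        rw [← hWW, show K * ((Nk * W) * (Nh * W)) = (K * (W * W)) * (Nk * Nh) by ring,
          Real.mul_rpow (x := K * (W * W)) (y := Nk * Nh) (by positivity) (by positivity)]
        ring
    _ = _ := by
        rw [← Real.rpow_add_of_nonneg (by positivity) (by linarith) hθ0.le]
        simp

end Interpolation

/-! ### The limit at time zero and the Duhamel formula -/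

section HeatFlow

open Module

variable {V : Type*} [NormedAddCommGroup V] [InnerProductSpace ℝ V]

theorem heatKernel_sqrt_smul {ε : ℝ} (hε : 0 < ε) (s : V) :
    heatKernel (ε : ℂ) (√ε • s) = ((√ε ^ finrank ℝ V)⁻¹ : ℝ) * heatKernel ((1 : ℝ) : ℂ) s := by
  rw [heatKernel_ofReal hε, heatKernel_ofReal one_pos, ← Complex.ofReal_mul]
  congr 1
  have h1 : (√ε ^ finrank ℝ V)⁻¹ = ε ^ (-(finrank ℝ V / 2 : ℝ)) := by
    rw [Real.rpow_neg hε.le, Real.sqrt_eq_rpow, ← Real.rpow_natCast, ← Real.rpow_mul hε.le]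
    congr 2
    ring
  rw [h1, Real.mul_rpow (by positivity) hε.le, norm_smul, mul_pow, Real.norm_of_nonneg (by positivity),
    Real.sq_sqrt hε.le, mul_one]
  have h2 : -(1 / (4 * ε)) * (ε * ‖s‖ ^ 2) = -(1 / (4 : ℝ)) * ‖s‖ ^ 2 := by field_simp
  rw [h2]
  simp only [mul_one]
  ring

variable [FiniteDimensional ℝ V] [MeasurableSpace V] [BorelSpace V]

theorem heatPairing_sub_right {ζ : ℂ} (hζ : 0 < ζ.re) {φ u v : V → ℂ} (hφ : Integrable φ)
    (hu : MemLp u 2) (hv : MemLp v 2) :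
    heatPairing ζ φ (u - v) = heatPairing ζ φ u - heatPairing ζ φ v := by
  unfold heatPairing
  rw [← integral_sub (integrable_heatPairing_of_memLp hζ hφ hu)
    (integrable_heatPairing_of_memLp hζ hφ hv)]
  refine integral_congr_ae (ae_of_all _ fun p => ?_)
  simp only [Pi.sub_apply]
  ring

/-- The substitution `y = x - √ε s` moves the dependence on `ε` from the kernel into the argument of
`u`, ready for dominated convergence. -/
theorem integral_heatKernel_mul_eq {ε : ℝ} (hε : 0 < ε) (x : V) (u : V → ℂ) :
    ∫ y, heatKernel (ε : ℂ) (x - y) * u y =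
      ∫ s, heatKernel ((1 : ℝ) : ℂ) s * u (x - √ε • s) := by
  have h1 : ∫ y, heatKernel (ε : ℂ) (x - y) * u y = ∫ s, heatKernel (ε : ℂ) s * u (x - s) := by
    rw [← integral_sub_left_eq_self (fun s => heatKernel (ε : ℂ) s * u (x - s)) volume x]
    simp
  have h2 := Measure.integral_comp_smul (volume : Measure V)
    (fun s => heatKernel (ε : ℂ) s * u (x - s)) (√ε)
  simp only [heatKernel_sqrt_smul hε, mul_assoc] at h2
  rw [integral_const_mul] at h2
  have hpos : 0 < (√ε ^ finrank ℝ V)⁻¹ := by positivity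
  rw [abs_of_pos hpos, Complex.real_smul] at h2
  rw [h1]
  exact (mul_left_cancel₀ (by exact_mod_cast hpos.ne') h2).symm

theorem heatPairing_eq_integral_integral {ζ : ℂ} {φ u : V → ℂ}
    (h : Integrable (fun p : V × V => φ p.1 * heatKernel ζ (p.1 - p.2) * u p.2)
      (volume.prod volume)) :
    heatPairing ζ φ u = ∫ x, φ x * ∫ y, heatKernel ζ (x - y) * u y := by
  rw [heatPairing, integral_prod _ h]
  refine integral_congr_ae (ae_of_all _ fun x => ?_)
  simp only
  rw [← integral_const_mul]
  simp only [mul_assoc]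

theorem tendsto_heatPairing_of_continuous {φ u : V → ℂ} (hφ : Integrable φ) (hu : MemLp u 2)
    (huc : Continuous u) {B : ℝ} (hB : ∀ x, ‖u x‖ ≤ B) :
    Tendsto (fun ε : ℝ => heatPairing (ε : ℂ) φ u) (𝓝[>] 0) (𝓝 (∫ x, φ x * u x)) := by
  have h1re : 0 < (((1 : ℝ) : ℂ)).re := by simp
  have hK := integrable_heatKernel (V := V) h1re
  have hpos : ∀ᶠ ε : ℝ in 𝓝[>] 0, 0 < ε := eventually_mem_nhdsWithin
  have hI : ∀ ε : ℝ, 0 < ε → Integrable (fun p : V × V =>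
      φ p.1 * heatKernel (ε : ℂ) (p.1 - p.2) * u p.2) (volume.prod volume) := fun ε hε =>
    integrable_heatPairing_of_memLp (by simpa using hε) hφ hu
  have heq : (fun ε : ℝ => ∫ x, φ x * ∫ s, heatKernel ((1 : ℝ) : ℂ) s * u (x - √ε • s)) =ᶠ[𝓝[>] 0]
      fun ε : ℝ => heatPairing (ε : ℂ) φ u := by
    filter_upwards [hpos] with ε hε
    rw [heatPairing_eq_integral_integral (hI ε hε)]
    simp only [integral_heatKernel_mul_eq hε]
  refine Tendsto.congr' heq ?_
  have hbd : ∀ (ε : ℝ) (x s : V), ‖heatKernel ((1 : ℝ) : ℂ) s * u (x - √ε • s)‖ ≤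
      ‖heatKernel ((1 : ℝ) : ℂ) s‖ * B := fun ε x s => by
    rw [norm_mul]
    gcongr
    exact hB _
  refine tendsto_integral_filter_of_dominated_convergence
    (fun x => ‖φ x‖ * ∫ s : V, ‖heatKernel ((1 : ℝ) : ℂ) s‖ * B) ?_ ?_ (hφ.norm.mul_const _) ?_
  · filter_upwards [hpos] with ε hε
    refine ((hI ε hε).integral_prod_left.aestronglyMeasurable).congr (ae_of_all _ fun x => ?_)
    simp only [mul_assoc]
    rw [integral_const_mul, integral_heatKernel_mul_eq hε]
  · refine Eventually.of_forall fun ε => ae_of_all _ fun x => ?_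
    rw [norm_mul]
    gcongr
    exact norm_integral_le_of_norm_le (hK.norm.mul_const _) (ae_of_all _ fun s => hbd ε x s)
  · refine ae_of_all _ fun x => Tendsto.const_mul _ ?_
    have hlim : u x = ∫ s : V, heatKernel ((1 : ℝ) : ℂ) s * u x := by
      rw [integral_mul_const, integral_heatKernel_ofReal one_pos, one_mul]
    conv_rhs => rw [hlim]
    refine tendsto_integral_filter_of_dominated_convergence
      (fun s => ‖heatKernel ((1 : ℝ) : ℂ) s‖ * B) (Eventually.of_forall fun ε => ?_)
      (Eventually.of_forall fun ε => ae_of_all _ fun s => hbd ε x s) (hK.norm.mul_const _)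
      (ae_of_all _ fun s => Tendsto.const_mul _ ?_)
    · refine ((continuous_heatKernel _).mul (huc.comp ?_)).aestronglyMeasurable
      fun_prop
    · have hc : Continuous fun ε : ℝ => u (x - √ε • s) := huc.comp (by fun_prop)
      have := (hc.tendsto 0).mono_left (nhdsWithin_le_nhds (s := Set.Ioi 0))
      simpa using this

theorem sqrt_integral_norm_sq_eq {f : V → ℂ} (hf : MemLp f 2) :
    √(∫ x, ‖f x‖ ^ 2) = (eLpNorm f 2 volume).toReal := by
  rw [hf.eLpNorm_eq_integral_rpow_norm two_ne_zero ENNReal.ofNat_ne_top,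
    ENNReal.toReal_ofReal (by positivity), Real.sqrt_eq_rpow]
  simp

theorem norm_integral_mul_le {f g : V → ℂ} (hf : MemLp f 2) (hg : MemLp g 2) :
    ‖∫ x, f x * g x‖ ≤ √(∫ x, ‖f x‖ ^ 2) * √(∫ x, ‖g x‖ ^ 2) :=
  (norm_integral_le_of_norm_le (hf.norm.integrable_mul hg.norm)
    (ae_of_all _ fun x => by simp)).trans (integral_mul_le_sqrt_mul_sqrt hf hg)

/-- Density of continuous compactly supported functions in `L₂`, together with the `L₂` bound on the
pairing, which is uniform in `ε`. -/
theorem tendsto_heatPairing {φ u : V → ℂ} (hφ : Integrable φ) (hφ2 : MemLp φ 2) (hu : MemLp u 2) :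
    Tendsto (fun ε : ℝ => heatPairing (ε : ℂ) φ u) (𝓝[>] 0) (𝓝 (∫ x, φ x * u x)) := by
  rw [Metric.tendsto_nhds]
  intro δ hδ
  set N := √(∫ x, ‖φ x‖ ^ 2)
  have hN : 0 ≤ N := Real.sqrt_nonneg _
  set η := δ / (3 * (N + 1))
  have hη : 0 < η := by positivity
  obtain ⟨v, hvc, hvu, hv, hv2⟩ := hu.exists_hasCompactSupport_eLpNorm_sub_le (by norm_num)
    (ENNReal.ofReal_pos.2 hη).ne'
  obtain ⟨B, hB⟩ := hvc.exists_bound_of_continuous hv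
  have huv : √(∫ x, ‖(u - v) x‖ ^ 2) ≤ η := by
    rw [sqrt_integral_norm_sq_eq (hu.sub hv2)]
    exact ENNReal.toReal_le_of_le_ofReal hη.le hvu
  have hNη : N * η < δ / 3 := by
    have : N * η = δ / 3 * (N / (N + 1)) := by
      simp only [η]
      field_simp
    rw [this]
    refine mul_lt_of_lt_one_right (by positivity) ((div_lt_one (by positivity)).2 (by linarith))
  have hpos : ∀ᶠ ε : ℝ in 𝓝[>] 0, 0 < ε := eventually_mem_nhdsWithin
  filter_upwards [hpos, Metric.tendsto_nhds.1 (tendsto_heatPairing_of_continuous hφ hv2 hv hB)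
    (δ / 3) (by positivity)] with ε hε h
  have hεre : 0 < (ε : ℂ).re := by simpa using hε
  rw [dist_eq_norm] at h ⊢
  have h1 : ‖heatPairing (ε : ℂ) φ (u - v)‖ ≤ N * η :=
    (norm_heatPairing_le_of_memLp hεre hφ hφ2 (hu.sub hv2)).trans (by gcongr)
  have h2 : ‖∫ x, φ x * (u - v) x‖ ≤ N * η :=
    (norm_integral_mul_le hφ2 (hu.sub hv2)).trans (by gcongr)
  have h3 : ∫ x, φ x * (u - v) x = (∫ x, φ x * u x) - ∫ x, φ x * v x := by
    have hi : ∀ {g : V → ℂ}, MemLp g 2 → Integrable fun x => φ x * g x := fun hg =>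
      hφ2.integrable_mul hg
    rw [← integral_sub (hi hu) (hi hv2)]
    refine integral_congr_ae (ae_of_all _ fun x => ?_)
    simp only [Pi.sub_apply]
    ring
  rw [heatPairing_sub_right hεre hφ hu hv2] at h1
  rw [h3] at h2
  have : heatPairing (ε : ℂ) φ u - ∫ x, φ x * u x =
      (heatPairing (ε : ℂ) φ u - heatPairing (ε : ℂ) φ v) +
      (heatPairing (ε : ℂ) φ v - ∫ x, φ x * v x) - ((∫ x, φ x * u x) - ∫ x, φ x * v x) := by ring
  rw [this]
  refine (norm_sub_le _ _).trans_lt ((add_le_add (norm_add_le _ _) h2).trans_lt ?_)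
  linarith

theorem hasDerivAt_heatPairing {ζ : ℂ} (hζ : 0 < ζ.re) {φ u : V → ℂ} (hφ : Integrable φ)
    (hu : MemLp u 2) :
    Integrable (fun p : V × V => φ p.1 * ((4 * ((4 * ζ)⁻¹) ^ 2 * (‖p.1 - p.2‖ ^ 2 : ℝ) -
        2 * (4 * ζ)⁻¹ * finrank ℝ V) * heatKernel ζ (p.1 - p.2)) * u p.2) (volume.prod volume) ∧
    HasDerivAt (fun ζ => heatPairing ζ φ u) (∫ p : V × V, φ p.1 *
      ((4 * ((4 * ζ)⁻¹) ^ 2 * (‖p.1 - p.2‖ ^ 2 : ℝ) - 2 * (4 * ζ)⁻¹ * finrank ℝ V) *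
        heatKernel ζ (p.1 - p.2)) * u p.2 ∂(volume.prod volume)) ζ := by
  obtain ⟨r, hr, C, c, hc, h⟩ := exists_norm_heatKernel_le (V := V) hζ
  have hbound := integrable_convolution_pairing (C := C) (k := fun x : V => (C * Real.exp (-c * ‖x‖ ^ 2) : ℝ))
    hc hφ hu.aestronglyMeasurable (hu.integrable_norm_pow two_ne_zero)
    (ae_of_all _ fun x => norm_le_one_add_sq (u x)) (by fun_prop) (fun x => by
      have hC : 0 ≤ C * Real.exp (-c * ‖x‖ ^ 2) :=
        (norm_nonneg _).trans ((h ζ (Metric.mem_ball_self hr)).2 x)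
      rw [Complex.norm_real, Real.norm_of_nonneg hC])
  refine integrable_and_hasDerivAt_integral_of_norm_le hr
    (F := fun ζ (p : V × V) => φ p.1 * heatKernel ζ (p.1 - p.2) * u p.2)
    (F' := fun ζ (p : V × V) => φ p.1 * ((4 * ((4 * ζ)⁻¹) ^ 2 * (‖p.1 - p.2‖ ^ 2 : ℝ) -
        2 * (4 * ζ)⁻¹ * finrank ℝ V) * heatKernel ζ (p.1 - p.2)) * u p.2)
    (fun w hw => (integrable_heatPairing_of_memLp (h w hw).1 hφ hu).aestronglyMeasurable) ?_
    hbound.norm (ae_of_all _ fun p w hw => ?_) (ae_of_all _ fun p w hw => ?_)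
  · refine (hφ.aestronglyMeasurable.comp_fst.mul ?_).mul hu.aestronglyMeasurable.comp_snd
    refine Continuous.aestronglyMeasurable ?_
    have := (continuous_heatKernel (V := V) ζ).comp (continuous_fst.sub continuous_snd)
    exact (by fun_prop : Continuous fun p : V × V => 4 * ((4 * ζ)⁻¹) ^ 2 *
      ((‖p.1 - p.2‖ ^ 2 : ℝ) : ℂ) - 2 * (4 * ζ)⁻¹ * finrank ℝ V).mul this
  · have hle := (h w hw).2 (p.1 - p.2)
    simp only [norm_mul, Complex.norm_real]
    gcongr
    refine hle.trans (le_of_eq ?_)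
    rw [← norm_mul, Real.norm_of_nonneg ((norm_nonneg _).trans hle)]
  · exact ((hasDerivAt_heatKernel (h w hw).1 (p.1 - p.2)).const_mul (φ p.1)).mul_const (u p.2)

/-- The kernel solves the heat equation in `ζ`, so differentiation puts a Laplacian on the Schwartz
function `y ↦ heatKernel ζ (x - y)`; for each `x`, `hpde` is applied to this test function. Here `f`
plays the role of `q u`. -/
theorem hasDerivAt_heatPairing_of_eigenfunction {ζ : ℂ} (hζ : 0 < ζ.re) {φ u f : V → ℂ} {r : V → ℝ}
    {z : ℂ} (hφ : Integrable φ) (hu : MemLp u 2) (hf : AEStronglyMeasurable f) (hr : Integrable r)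
    (hfr : ∀ᵐ y, ‖f y‖ ≤ 1 + r y)
    (hpde : ∀ ψ : 𝓢(V, ℂ), ∫ y, (Δ ψ) y * u y = (∫ y, ψ y * f y) - z * ∫ y, ψ y * u y) :
    HasDerivAt (fun ζ => heatPairing ζ φ u) (heatPairing ζ φ f - z * heatPairing ζ φ u) ζ := by
  obtain ⟨hint, hd⟩ := hasDerivAt_heatPairing hζ hφ hu
  refine hd.congr_deriv ?_
  have hIu := integrable_heatPairing_of_memLp hζ hφ hu
  have hIf := integrable_heatPairing hζ hφ hf hr hfr
  rw [integral_prod _ hint, heatPairing, heatPairing, integral_prod _ hIu, integral_prod _ hIf,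
    ← integral_const_mul, ← integral_sub hIf.integral_prod_left (hIu.integral_prod_left.const_mul z)]
  refine integral_congr_ae (ae_of_all _ fun x => ?_)
  simp only [mul_assoc (φ x)]
  rw [integral_const_mul, integral_const_mul, integral_const_mul]
  simp only [← heatKernel_laplacian hζ]
  simp only [heatKernel_sub_eq_gaussianSchwartz hζ]
  rw [hpde]
  ring

/-- Duhamel: multiplying the pairing with `u` along `ε + iσt` by `e^{iσzt}` cancels the `z` term,
leaving only the source `f` in the derivative. The product vanishes as `t → ∞`, so its value at `t =
0` is minus the integral of that derivative; then `ε → 0`. -/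
theorem norm_integral_mul_le_of_eigenfunction {φ u f : V → ℂ} {r : V → ℝ} {z : ℂ}
    (hφ : Integrable φ) (hφ2 : MemLp φ 2) (hu : MemLp u 2) (hf : AEStronglyMeasurable f)
    (hr : Integrable r) (hfr : ∀ᵐ y, ‖f y‖ ≤ 1 + r y)
    (hpde : ∀ ψ : 𝓢(V, ℂ), ∫ y, (Δ ψ) y * u y = (∫ y, ψ y * f y) - z * ∫ y, ψ y * u y)
    {σ : ℝ} (hσ : |σ| = 1) (hσz : 0 < σ * z.im) {N : ℝ → ℝ}
    (hN : IntegrableOn (fun t => Real.exp (-(σ * z.im) * t) * N t) (Set.Ioi 0))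
    (hle : ∀ ε > (0 : ℝ), ∀ t > (0 : ℝ), ‖heatPairing (ε + σ * t * Complex.I) φ f‖ ≤ N t) :
    ‖∫ x, φ x * u x‖ ≤ ∫ t in Set.Ioi 0, Real.exp (-(σ * z.im) * t) * N t := by
  have hpos : ∀ᶠ ε : ℝ in 𝓝[>] 0, 0 < ε := eventually_mem_nhdsWithin
  refine le_of_tendsto (tendsto_heatPairing hφ hφ2 hu).norm ?_
  filter_upwards [hpos] with ε hε
  have hre : ∀ t : ℝ, 0 < ((ε : ℂ) + σ * t * Complex.I).re := fun t => by simpa using hε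
  set M : ℝ → ℂ := fun t => Complex.exp (Complex.I * σ * z * t) *
    heatPairing (ε + σ * t * Complex.I) φ u
  set M' : ℝ → ℂ := fun t => Complex.I * σ * (Complex.exp (Complex.I * σ * z * t) *
    heatPairing (ε + σ * t * Complex.I) φ f)
  have hexp : ∀ t : ℝ, ‖Complex.exp (Complex.I * σ * z * t)‖ = Real.exp (-(σ * z.im) * t) := by
    intro t
    rw [Complex.norm_exp]
    congr 1
    simp
  have hM : ∀ t, HasDerivAt M (M' t) t := by
    intro t
    have h1 : HasDerivAt (fun t : ℝ => (ε : ℂ) + σ * t * Complex.I) (σ * Complex.I) t := by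
      have := (((hasDerivAt_id t).ofReal_comp.const_mul (σ : ℂ)).mul_const Complex.I).const_add (ε : ℂ)
      simpa using this
    have h2 := (hasDerivAt_heatPairing_of_eigenfunction (hre t) hφ hu hf hr hfr hpde).comp
      t h1
    have h3 : HasDerivAt (fun t : ℝ => Complex.exp (Complex.I * σ * z * t))
        (Complex.exp (Complex.I * σ * z * t) * (Complex.I * σ * z)) t := by
      have := ((hasDerivAt_id t).ofReal_comp.const_mul (Complex.I * σ * z)).cexp
      simpa using this
    refine (h3.mul h2).congr_deriv ?_
    simp only [M', Function.comp]
    ring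
  have hM'le : ∀ t > (0 : ℝ), ‖M' t‖ ≤ Real.exp (-(σ * z.im) * t) * N t := by
    intro t ht
    simp only [M', norm_mul, hexp, Complex.norm_I, Complex.norm_real, Real.norm_eq_abs, hσ, one_mul]
    gcongr
    exact hle ε hε t ht
  have hM'i : IntegrableOn M' (Set.Ioi 0) := by
    refine hN.mono' ?_ ((ae_restrict_iff' measurableSet_Ioi).2 (ae_of_all _ hM'le))
    -- Measurability of `M'` comes for free from its being a derivative.
    rw [show M' = deriv M from funext fun t => (hM t).deriv.symm]
    exact (stronglyMeasurable_deriv M).aestronglyMeasurable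
  have hlim : Tendsto M atTop (𝓝 0) := by
    have h0 : Tendsto (fun t : ℝ => Real.exp (-(σ * z.im) * t) *
        (√(∫ x, ‖φ x‖ ^ 2) * √(∫ x, ‖u x‖ ^ 2))) atTop (𝓝 0) := by
      rw [← zero_mul (√(∫ x, ‖φ x‖ ^ 2) * √(∫ x, ‖u x‖ ^ 2))]
      refine Tendsto.mul_const _ (Real.tendsto_exp_atBot.comp ?_)
      exact tendsto_id.const_mul_atTop_of_neg (by linarith)
    refine squeeze_zero_norm (fun t => ?_) h0
    rw [norm_mul, hexp]
    gcongr
    exact norm_heatPairing_le_of_memLp (hre t) hφ hφ2 hu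
  have hftc := integral_Ioi_of_hasDerivAt_of_tendsto (hM 0).continuousAt.continuousWithinAt
    (fun t _ => hM t) hM'i hlim
  have hM0 : M 0 = heatPairing (ε : ℂ) φ u := by simp [M]
  rw [← hM0, ← norm_neg, ← zero_sub, ← hftc]
  exact norm_integral_le_of_norm_le hN ((ae_restrict_iff' measurableSet_Ioi).2 (ae_of_all _ hM'le))

end HeatFlow

/-! ### The Birman–Schwinger inequality for an eigenfunction -/

section Eigenvalue

open Module

variable {V : Type*} [NormedAddCommGroup V] [InnerProductSpace ℝ V] [FiniteDimensional ℝ V]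
  [MeasurableSpace V] [BorelSpace V]

theorem integral_norm_sq_le_of_forall_indicator {v : V → ℂ} (hv : MemLp v 2) {A : ℕ → Set V}
    (hA : ∀ i, MeasurableSet (A i)) (hmono : Monotone A) (hU : ⋃ i, A i = Set.univ) {c : ℝ}
    (h : ∀ i, ∫ x, ‖(A i).indicator v x‖ ^ 2 ≤ c) : ∫ x, ‖v x‖ ^ 2 ≤ c := by
  have hi := hv.integrable_norm_pow two_ne_zero
  have hl := tendsto_setIntegral_of_monotone hA hmono (f := fun x => ‖v x‖ ^ 2) hi.integrableOn
  rw [hU, setIntegral_univ] at hl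
  refine le_of_tendsto hl (Eventually.of_forall fun i => ?_)
  refine le_trans (le_of_eq ?_) (h i)
  rw [← integral_indicator (hA i)]
  congr 1
  ext x
  by_cases hx : x ∈ A i <;> simp [hx]

/-- The power of `t` is `-(d/2)/ρ = γ/ρ - 1`, so this is a Gamma integral, convergent at `0` because
`γ > 0`. -/
theorem integral_exp_mul_rpow {d ρ γ b Q : ℝ} (hd : 0 ≤ d) (hγ : 0 < γ) (hρ : ρ = γ + d / 2)
    (hb : 0 < b) (hQ : 0 ≤ Q) :
    IntegrableOn (fun t => Real.exp (-b * t) * ((4 * Real.pi * t) ^ (-(d / 2)) * Q) ^ (1 / ρ))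
      (Set.Ioi 0) ∧
    ∫ t in Set.Ioi 0, Real.exp (-b * t) * ((4 * Real.pi * t) ^ (-(d / 2)) * Q) ^ (1 / ρ) =
      ((4 * Real.pi) ^ (-(d / 2)) * Q) ^ (1 / ρ) * ((1 / b) ^ (γ / ρ) * Real.Gamma (γ / ρ)) := by
  have hρ0 : 0 < ρ := by rw [hρ]; positivity
  have hs : 0 < γ / ρ := by positivity
  have h1 := Real.integral_rpow_mul_exp_neg_mul_Ioi hs hb
  have hG := Real.Gamma_pos_of_pos hs
  have h2 : IntegrableOn (fun t : ℝ => t ^ (γ / ρ - 1) * Real.exp (-(b * t))) (Set.Ioi 0) := by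
    -- A nonintegrable function has integral `0` by convention, so the positive value of the
    -- integral yields integrability.
    refine Integrable.of_integral_ne_zero ?_
    rw [h1]
    positivity
  have h3 : ∀ t ∈ Set.Ioi (0 : ℝ), ((4 * Real.pi) ^ (-(d / 2)) * Q) ^ (1 / ρ) *
      (t ^ (γ / ρ - 1) * Real.exp (-(b * t))) =
      Real.exp (-b * t) * ((4 * Real.pi * t) ^ (-(d / 2)) * Q) ^ (1 / ρ) := by
    intro t ht
    have ht : 0 < t := ht
    have he : -(d / 2) * (1 / ρ) = γ / ρ - 1 := by
      rw [show d / 2 = ρ - γ by rw [hρ]; ring]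
      field_simp
      ring
    rw [Real.mul_rpow (by positivity) ht.le, mul_right_comm, Real.mul_rpow (by positivity)
      (by positivity) (y := t ^ (-(d / 2))), ← Real.rpow_mul ht.le, he, neg_mul]
    ring
  refine ⟨IntegrableOn.congr_fun (h2.const_mul _) h3 measurableSet_Ioi, ?_⟩
  rw [← setIntegral_congr_fun measurableSet_Ioi h3, integral_const_mul, h1]

theorem closedBall_exhaustion (V : Type*) [NormedAddCommGroup V] [MeasurableSpace V] [BorelSpace V] :
    (∀ i : ℕ, MeasurableSet (Metric.closedBall (0 : V) i)) ∧
    (Monotone fun i : ℕ => Metric.closedBall (0 : V) i) ∧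
    ⋃ i : ℕ, Metric.closedBall (0 : V) i = Set.univ :=
  ⟨fun _ => Metric.isClosed_closedBall.measurableSet,
    fun _ _ hij => Metric.closedBall_subset_closedBall (by exact_mod_cast hij),
    Metric.iUnion_closedBall_nat 0⟩

theorem exists_abs_eq_one_mul_eq_abs {a : ℝ} : ∃ σ : ℝ, |σ| = 1 ∧ σ * a = |a| := by
  rcases le_total 0 a with h | h
  · exact ⟨1, by simp, by simp [abs_of_nonneg h]⟩
  · exact ⟨-1, by simp, by simp [abs_of_nonpos h]⟩

/-- The Duhamel bound with zero source, tested against the conjugate of `u` cut off to balls: the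
free Laplacian has no nonreal eigenvalue. -/
theorem ae_eq_zero_of_laplacian_eigenfunction {u : V → ℂ} {z : ℂ} (hu : MemLp u 2) (hz : z.im ≠ 0)
    (hpde : ∀ ψ : 𝓢(V, ℂ), ∫ y, (Δ ψ) y * u y = - (z * ∫ y, ψ y * u y)) : u =ᵐ[volume] 0 := by
  obtain ⟨σ, hσ, hσz⟩ := exists_abs_eq_one_mul_eq_abs (a := z.im)
  obtain ⟨hA, hmono, hU⟩ := closedBall_exhaustion V
  have hc : MemLp (fun x => starRingEnd ℂ (u x)) 2 := hu.of_le
    (Complex.continuous_conj.comp_aestronglyMeasurable hu.1) (ae_of_all _ fun x => by simp)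
  have h0 : ∫ x, ‖u x‖ ^ 2 ≤ 0 := by
    refine integral_norm_sq_le_of_forall_indicator hu hA hmono hU fun i => ?_
    have h := norm_integral_mul_le_of_eigenfunction (z := z) (f := 0) (r := 0) (N := 0)
      (hc.integrable_indicator_two (hA i) measure_closedBall_lt_top.ne) (hc.indicator (hA i)) hu
      aestronglyMeasurable_zero (integrable_zero _ _ _) (by simp) (fun ψ => by simp [hpde ψ]) hσ
      (by rw [hσz]; positivity) (by simp) (fun ε _ t _ => by simp [heatPairing])
    have he : ∫ x, (Metric.closedBall (0 : V) i).indicator (fun x => starRingEnd ℂ (u x)) x * u x =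
        ((∫ x, ‖(Metric.closedBall (0 : V) i).indicator u x‖ ^ 2 : ℝ) : ℂ) := by
      rw [← integral_complex_ofReal]
      congr 1
      ext x
      by_cases hx : x ∈ Metric.closedBall (0 : V) i
      · simp only [Set.indicator_of_mem hx, Complex.conj_mul']
        push_cast
        rfl
      · simp [Set.indicator_of_notMem hx]
    rw [he, Complex.norm_real] at h
    simpa using (Real.le_norm_self _).trans h
  have h1 := (integral_eq_zero_iff_of_nonneg (fun x => by positivity)
    (hu.integrable_norm_pow two_ne_zero)).1 (le_antisymm h0 (integral_nonneg fun x => by positivity))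
  filter_upwards [h1] with x hx
  simpa using hx

theorem norm_integral_mul_weight_le {u k h : V → ℂ} {w r : V → ℝ} {z : ℂ} {γ ρ : ℝ} (hγ : 0 < γ)
    (hρ : ρ = γ + finrank ℝ V / 2) (hρ1 : 1 ≤ ρ) (hu : MemLp u 2) (hk : MemLp k 2) (hh : MemLp h 2)
    (hw : Measurable w) (hw0 : ∀ x, 0 ≤ w x) (hw2 : Integrable fun x => w x ^ 2) (hz : z.im ≠ 0)
    (hki : Integrable fun x => k x * (w x ^ (1 / ρ) : ℝ))
    (hk2 : MemLp (fun x => k x * (w x ^ (1 / ρ) : ℝ)) 2)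
    (hr : Integrable r) (hhr : ∀ᵐ y, ‖h y * (w y ^ (1 / ρ) : ℝ)‖ ≤ 1 + r y)
    (hpde : ∀ ψ : 𝓢(V, ℂ), ∫ y, (Δ ψ) y * u y =
      (∫ y, ψ y * (h y * (w y ^ (1 / ρ) : ℝ))) - z * ∫ y, ψ y * u y) :
    ‖∫ x, k x * (w x ^ (1 / ρ) : ℝ) * u x‖ ≤
      (∫ t in Set.Ioi 0, Real.exp (-|z.im| * t) * ((4 * Real.pi * t) ^ (-(finrank ℝ V / 2 : ℝ)) *
        ∫ x, w x ^ 2) ^ (1 / ρ)) * (√(∫ x, ‖k x‖ ^ 2) * √(∫ x, ‖h x‖ ^ 2)) := by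
  have hρ0 : 0 < ρ := by linarith
  obtain ⟨σ, hσ, hσz⟩ := exists_abs_eq_one_mul_eq_abs (a := z.im)
  have hb : 0 < |z.im| := abs_pos.2 hz
  have hQ0 : 0 ≤ ∫ x, w x ^ 2 := integral_nonneg fun x => by positivity
  obtain ⟨hJi, -⟩ := integral_exp_mul_rpow (d := finrank ℝ V) (Nat.cast_nonneg _) hγ hρ hb hQ0
  have hfm : AEStronglyMeasurable fun x => h x * (w x ^ (1 / ρ) : ℝ) :=
    hh.1.mul (Measurable.aestronglyMeasurable (by fun_prop))
  rw [← hσz] at hJi hb ⊢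
  rw [← integral_mul_const]
  simp only [mul_assoc (Real.exp _)]
  refine norm_integral_mul_le_of_eigenfunction hki hk2 hu hfm hr hhr hpde hσ hb
    (N := fun t => ((4 * Real.pi * t) ^ (-(finrank ℝ V / 2 : ℝ)) * ∫ x, w x ^ 2) ^ (1 / ρ) *
      (√(∫ x, ‖k x‖ ^ 2) * √(∫ x, ‖h x‖ ^ 2))) ?_ fun ε hε t ht => ?_
  · have := hJi.mul_const (√(∫ x, ‖k x‖ ^ 2) * √(∫ x, ‖h x‖ ^ 2))
    simp only [mul_assoc (Real.exp _)] at this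
    exact this
  · have hre : 0 < ((ε : ℂ) + σ * t * Complex.I).re := by simpa using hε
    -- The kernel bound at `ε + iσt` is thus no worse than the one at modulus `t`, uniformly in `ε`.
    have hnorm : t ≤ ‖(ε : ℂ) + σ * t * Complex.I‖ := by
      have h1 := Complex.abs_im_le_norm ((ε : ℂ) + σ * t * Complex.I)
      have h2 : ((ε : ℂ) + σ * t * Complex.I).im = σ * t := by simp
      rwa [h2, abs_mul, hσ, one_mul, abs_of_pos ht] at h1
    have hint := integrable_heatPairing hre (f := fun x => k x * (w x ^ (1 / ρ) : ℝ))
      (g := fun x => h x * (w x ^ (1 / ρ) : ℝ)) hki hfm hr hhr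
    have hle := norm_heatPairing_weighted_le hre hk hh hw hw0 hw2
      (θ := 1 / ρ) (by positivity) ((div_le_one hρ0).2 hρ1) hint
    refine hle.trans (mul_le_mul_of_nonneg_right ?_ (by positivity))
    refine Real.rpow_le_rpow (by positivity) (mul_le_mul_of_nonneg_right ?_ hQ0) (by positivity)
    refine Real.rpow_le_rpow_of_nonpos (by positivity) (by gcongr) ?_
    have : (0 : ℝ) ≤ finrank ℝ V := Nat.cast_nonneg _
    linarith

/-- Choosing for `k` the conjugate of `v` truncated to a set `A` gives `‖1_A v‖² ≤ J ‖1_A v‖ ‖v‖`,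
hence `‖1_A v‖ ≤ J ‖v‖`. Exhausting the space gives `‖v‖ ≤ J ‖v‖`, and `v` is nonzero. -/
theorem one_le_of_forall_norm_integral_le {u v : V → ℂ} {s : V → ℝ} {J : ℝ} (hs : Measurable s)
    (hs0 : ∀ x, 0 ≤ s x) (hv : MemLp v 2) (hvs : ∀ᵐ x, v x = s x * u x) (hJ0 : 0 ≤ J)
    (hvpos : 0 < ∫ x, ‖v x‖ ^ 2)
    (key : ∀ k : V → ℂ, MemLp k 2 → Integrable (fun x => k x * (s x : ℂ)) →
      MemLp (fun x => k x * (s x : ℂ)) 2 →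
      ‖∫ x, k x * (s x : ℂ) * u x‖ ≤ J * (√(∫ x, ‖k x‖ ^ 2) * √(∫ x, ‖v x‖ ^ 2))) : 1 ≤ J := by
  set S := √(∫ x, ‖v x‖ ^ 2) with hS
  have hSpos : 0 < S := Real.sqrt_pos.2 hvpos
  have hSS : S ^ 2 = ∫ x, ‖v x‖ ^ 2 := Real.sq_sqrt hvpos.le
  obtain ⟨hA, hmono, hU⟩ := closedBall_exhaustion V
  -- On `A i` the weight `s` is bounded and the volume finite, so `k s` lies in both `L₁` and `L₂`,
  -- as `key` requires.
  set A : ℕ → Set V := fun i => Metric.closedBall 0 i ∩ {x | s x ≤ i} with hAdef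
  have hAm : ∀ i, MeasurableSet (A i) := fun i =>
    (hA i).inter (measurableSet_le (by fun_prop) measurable_const)
  have hAfin : ∀ i, volume (A i) ≠ ⊤ := fun i => ne_top_of_le_ne_top
    (measure_closedBall_lt_top (μ := (volume : Measure V)) (x := (0 : V)) (r := i)).ne
    (measure_mono Set.inter_subset_left)
  have hAmono : Monotone A := fun i j hij =>
    Set.inter_subset_inter (hmono hij) fun x (hx : s x ≤ i) =>
      hx.trans (by exact_mod_cast hij)
  have hAU : ⋃ i, A i = Set.univ := by
    refine Set.eq_univ_of_forall fun x => ?_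
    obtain ⟨i, hi⟩ := exists_nat_ge (max ‖x‖ (s x))
    exact Set.mem_iUnion.2 ⟨i, by simpa using (le_max_left _ _).trans hi, (le_max_right _ _).trans hi⟩
  have hle : ∫ x, ‖v x‖ ^ 2 ≤ (J * S) ^ 2 := by
    refine integral_norm_sq_le_of_forall_indicator hv hAm hAmono hAU fun i => ?_
    set c : V → ℂ := fun x => starRingEnd ℂ (v x)
    have hc : MemLp c 2 := hv.of_le
      (Complex.continuous_conj.comp_aestronglyMeasurable hv.1) (ae_of_all _ fun x => by simp [c])
    set k : V → ℂ := (A i).indicator c with hk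
    have hk2 : MemLp k 2 := hc.indicator (hAm i)
    have hk1 : Integrable k := hc.integrable_indicator_two (hAm i) (hAfin i)
    have hbd : ∀ x, ‖k x * (s x : ℂ)‖ ≤ i * ‖k x‖ := fun x => by
      by_cases hx : x ∈ A i
      · rw [norm_mul, mul_comm, Complex.norm_real, Real.norm_of_nonneg (hs0 x)]
        gcongr
        exact hx.2
      · simp [hk, Set.indicator_of_notMem hx]
    have hmeas : AEStronglyMeasurable (fun x => k x * (s x : ℂ)) :=
      hk2.1.mul (Measurable.aestronglyMeasurable (by fun_prop))
    have h1 := key k hk2 ((hk1.norm.const_mul _).mono' hmeas (ae_of_all _ hbd))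
      (hk2.of_le_mul hmeas (ae_of_all _ hbd))
    have hkn : ∫ x, ‖k x‖ ^ 2 = ∫ x, ‖(A i).indicator v x‖ ^ 2 :=
      integral_norm_sq_congr_norm fun x => by
        by_cases hx : x ∈ A i <;> simp [hk, c, hx]
    have he : ∫ x, k x * (s x : ℂ) * u x =
        ((∫ x, ‖(A i).indicator v x‖ ^ 2 : ℝ) : ℂ) := by
      rw [← integral_complex_ofReal]
      refine integral_congr_ae ?_
      filter_upwards [hvs] with x hx
      by_cases hxA : x ∈ A i
      · simp only [hk, c, Set.indicator_of_mem hxA, mul_assoc, ← hx]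
        rw [Complex.conj_mul']
        push_cast
        rfl
      · simp [hk, Set.indicator_of_notMem hxA]
    set T := √(∫ x, ‖(A i).indicator v x‖ ^ 2) with hT
    have hTT : T ^ 2 = ∫ x, ‖(A i).indicator v x‖ ^ 2 :=
      Real.sq_sqrt (integral_nonneg fun x => by positivity)
    have hT0 : 0 ≤ T := Real.sqrt_nonneg _
    rw [he, hkn, ← hTT, Real.sqrt_sq hT0, Complex.norm_real, Real.norm_of_nonneg (by positivity)] at h1
    rw [← hTT]
    gcongr
    rcases hT0.eq_or_lt with h0 | h0
    · rw [← h0]; positivity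
    · exact le_of_mul_le_mul_left (by linarith) h0
  rw [← hSS] at hle
  have := (pow_le_pow_iff_left₀ hSpos.le (by positivity) two_ne_zero).1 hle
  exact le_of_mul_le_mul_right (by linarith) hSpos

theorem abs_im_rpow_le_of_weak_eigenfunction {q u : V → ℂ} {z : ℂ} {γ ρ : ℝ} (hγ : 0 < γ)
    (hρ : ρ = γ + finrank ℝ V / 2) (hρ1 : 1 ≤ ρ) (hq : MemLp q (ENNReal.ofReal ρ)) (hu : MemLp u 2)
    (hv : MemLp (fun x => (Real.sqrt ‖q x‖ : ℂ) * u x) 2) (hz : z.im ≠ 0) (hu0 : ¬ u =ᵐ[volume] 0)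
    (hpde : ∀ ψ : 𝓢(V, ℂ),
      ∫ y, (Δ ψ) y * u y = (∫ y, q y * u y * ψ y) - z * ∫ y, ψ y * u y) :
    |z.im| ^ γ ≤ (4 * Real.pi) ^ (-(finrank ℝ V / 2 : ℝ)) * Real.Gamma (γ / ρ) ^ ρ *
      ∫ x, ‖q x‖ ^ ρ := by
  have hρ0 : 0 < ρ := by linarith
  have hb : 0 < |z.im| := abs_pos.2 hz
  set v : V → ℂ := fun x => (Real.sqrt ‖q x‖ : ℂ) * u x with hvdef
  set Q := ∫ x, ‖q x‖ ^ ρ with hQdef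
  have hQ0 : 0 ≤ Q := integral_nonneg fun x => by positivity
  have hqi : Integrable fun x => ‖q x‖ ^ ρ := by
    have := hq.integrable_norm_rpow (by simpa using hρ0) ENNReal.ofReal_ne_top
    rwa [ENNReal.toReal_ofReal hρ0.le] at this
  set m : V → ℂ := hq.1.mk q with hm
  have hmm : Measurable m := hq.1.stronglyMeasurable_mk.measurable
  have hqm : q =ᵐ[volume] m := hq.1.ae_eq_mk
  -- The exponent makes `w²` equal to `|q|^ρ` and `w^{1/ρ}` equal to `|q|^{1/2}` almost everywhere.
  set w : V → ℝ := fun x => ‖m x‖ ^ (ρ / 2) with hw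
  have hwm : Measurable w := by fun_prop
  have hw2 : ∀ x, w x ^ 2 = ‖m x‖ ^ ρ := fun x => by
    rw [hw, ← Real.rpow_natCast, ← Real.rpow_mul (norm_nonneg _)]
    congr 1
    push_cast
    ring
  have hwθ : ∀ x, w x ^ (1 / ρ) = √‖m x‖ := fun x => by
    rw [hw, ← Real.rpow_mul (norm_nonneg _), Real.sqrt_eq_rpow]
    congr 1
    field_simp
  have hw2ae : (fun x => ‖q x‖ ^ ρ) =ᵐ[volume] fun x => w x ^ 2 := by
    filter_upwards [hqm] with x hx
    rw [hw2, hx]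
  have hwi : Integrable fun x => w x ^ 2 := hqi.congr hw2ae
  have hwQ : ∫ x, w x ^ 2 = Q := (integral_congr_ae hw2ae).symm
  -- Polar decomposition of `q`: the phase goes into `h`, and division by zero gives phase `0` where
  -- `m` vanishes.
  set h : V → ℂ := fun x => m x / ‖m x‖ * v x with hh
  have hhv : ∀ x, ‖h x‖ ≤ ‖v x‖ := fun x => by
    rw [hh]
    simp only [norm_mul, norm_div, Complex.norm_real, norm_norm]
    exact mul_le_of_le_one_left (norm_nonneg _) (div_self_le_one _)
  have hh2 : MemLp h 2 := by
    refine hv.of_le (AEStronglyMeasurable.mul ?_ hv.1) (ae_of_all _ hhv)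
    exact (hmm.div (by fun_prop)).aestronglyMeasurable
  have hhvi : ∫ x, ‖h x‖ ^ 2 ≤ ∫ x, ‖v x‖ ^ 2 := integral_mono_of_nonneg
    (ae_of_all _ fun x => by positivity) (hv.integrable_norm_pow two_ne_zero)
    (ae_of_all _ fun x => pow_le_pow_left₀ (norm_nonneg _) (hhv x) 2)
  set f : V → ℂ := fun x => h x * (w x ^ (1 / ρ) : ℝ) with hf
  have hfq : f =ᵐ[volume] fun x => q x * u x := by
    filter_upwards [hqm] with x hx
    simp only [hf, hh, hwθ, hvdef, hx]
    by_cases h0 : m x = 0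
    · simp [h0]
    · have h1 : (‖m x‖ : ℂ) ≠ 0 := by simpa using h0
      have h2 : ((√‖m x‖ : ℝ) : ℂ) * ((√‖m x‖ : ℝ) : ℂ) = ‖m x‖ := by
        rw [← Complex.ofReal_mul, Real.mul_self_sqrt (norm_nonneg _)]
      calc _ = m x / ‖m x‖ * u x * (((√‖m x‖ : ℝ) : ℂ) * ((√‖m x‖ : ℝ) : ℂ)) := by ring
        _ = _ := by rw [h2]; field_simp
  have hri : Integrable fun x => w x ^ 2 + ‖v x‖ ^ 2 := hwi.add (hv.integrable_norm_pow two_ne_zero)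
  -- From `|f| ≤ |v| |m|^{1/2}`, the arithmetic–geometric mean inequality, and `|m| ≤ 1 + |m|^ρ`,
  -- valid because `ρ ≥ 1`.
  have hfr : ∀ᵐ y, ‖f y‖ ≤ 1 + (w y ^ 2 + ‖v y‖ ^ 2) := ae_of_all _ fun y => by
    have h1 : ‖m y‖ ≤ 1 + ‖m y‖ ^ ρ := by
      rcases le_total ‖m y‖ 1 with hl | hl
      · have : 0 ≤ ‖m y‖ ^ ρ := by positivity
        linarith
      · have := Real.rpow_le_rpow_of_exponent_le hl hρ1
        rw [Real.rpow_one] at this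
        linarith
    have h2 : ‖f y‖ ≤ ‖v y‖ * √‖m y‖ := by
      simp only [hf, norm_mul, hwθ, Complex.norm_real, Real.norm_of_nonneg (Real.sqrt_nonneg _)]
      gcongr
      exact hhv y
    have h3 := Real.sq_sqrt (norm_nonneg (m y))
    rw [hw2]
    nlinarith [sq_nonneg (‖v y‖ - √‖m y‖), sq_nonneg ‖v y‖, norm_nonneg (m y)]
  have hpdef : ∀ ψ : 𝓢(V, ℂ),
      ∫ y, (Δ ψ) y * u y = (∫ y, ψ y * f y) - z * ∫ y, ψ y * u y := by
    intro ψ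
    rw [hpde ψ]
    congr 1
    refine integral_congr_ae ?_
    filter_upwards [hfq] with x hx
    rw [hx]
    ring
  obtain ⟨-, hJ⟩ := integral_exp_mul_rpow (d := finrank ℝ V) (Nat.cast_nonneg _) hγ hρ hb hQ0
  set J := ∫ t in Set.Ioi 0, Real.exp (-|z.im| * t) *
    ((4 * Real.pi * t) ^ (-(finrank ℝ V / 2 : ℝ)) * Q) ^ (1 / ρ) with hJdef
  have hJ0 : 0 ≤ J := by
    rw [hJ]
    have := Real.Gamma_pos_of_pos (div_pos hγ hρ0)
    positivity
  have key : ∀ k : V → ℂ, MemLp k 2 → Integrable (fun x => k x * (w x ^ (1 / ρ) : ℝ)) →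
      MemLp (fun x => k x * (w x ^ (1 / ρ) : ℝ)) 2 →
      ‖∫ x, k x * (w x ^ (1 / ρ) : ℝ) * u x‖ ≤
        J * (√(∫ x, ‖k x‖ ^ 2) * √(∫ x, ‖v x‖ ^ 2)) := by
    intro k hk hki hk2
    refine (norm_integral_mul_weight_le hγ hρ hρ1 hu hk hh2 hwm (fun x => by positivity) hwi hz
      hki hk2 hri hfr hpdef).trans ?_
    rw [hwQ]
    exact mul_le_mul_of_nonneg_left (mul_le_mul_of_nonneg_left (Real.sqrt_le_sqrt hhvi)
      (by positivity)) hJ0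
  -- If `v` vanished, so would `q u`, and `u` would be an eigenfunction of the free Laplacian with a
  -- nonreal eigenvalue.
  have hvpos : 0 < ∫ x, ‖v x‖ ^ 2 := by
    refine lt_of_le_of_ne (integral_nonneg fun x => by positivity) fun h0 => hu0 ?_
    have h1 := (integral_eq_zero_iff_of_nonneg (fun x => by positivity)
      (hv.integrable_norm_pow two_ne_zero)).1 h0.symm
    refine ae_eq_zero_of_laplacian_eigenfunction hu hz fun ψ => ?_
    rw [hpdef, integral_eq_zero_of_ae, zero_sub]
    filter_upwards [h1] with x hx
    have hvx : v x = 0 := by simpa using hx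
    simp [hf, hh, hvx]
  have hJ1 : 1 ≤ J := by
    refine one_le_of_forall_norm_integral_le (u := u) (s := fun x => w x ^ (1 / ρ)) (by fun_prop)
      (fun x => by positivity) hv ?_ hJ0 hvpos key
    filter_upwards [hqm] with x hx
    rw [hwθ, ← hx]
  have hG := Real.Gamma_pos_of_pos (div_pos hγ hρ0)
  -- Raising `1 ≤ J` to the power `ρ` turns `(1/|Im z|)^{γ/ρ}` into `|Im z|^{-γ}` and clears the
  -- exponent `1/ρ`.
  have h1 := Real.one_le_rpow hJ1 hρ0.le
  rw [hJ, Real.mul_rpow (by positivity) (by positivity), ← Real.rpow_mul (by positivity),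
    one_div_mul_cancel hρ0.ne', Real.rpow_one, Real.mul_rpow (by positivity) hG.le,
    ← Real.rpow_mul (by positivity), div_mul_cancel₀ _ hρ0.ne', Real.div_rpow zero_le_one hb.le,
    Real.one_rpow] at h1
  have hbγ : 0 < |z.im| ^ γ := by positivity
  calc |z.im| ^ γ = |z.im| ^ γ * 1 := (mul_one _).symm
    _ ≤ |z.im| ^ γ * ((4 * Real.pi) ^ (-(finrank ℝ V / 2 : ℝ)) * Q *
        (1 / |z.im| ^ γ * Real.Gamma (γ / ρ) ^ ρ)) := by gcongr
    _ = _ := by field_simp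

end Eigenvalue

theorem mainTheorem6 (n : ℕ) (hn : 3 ≤ n) (γ : ℝ) (hγ : 0 < γ)
    (q : EuclideanSpace ℝ (Fin n) → ℂ)
    (hq : MemLp q (ENNReal.ofReal (γ + n / 2)) volume)
    (z : ℂ) (hz : (schrodingerOperator q).IsEigenvalue z) (hzim : z.im ≠ 0) :
    |z.im| ^ γ ≤
      (4 * Real.pi) ^ (-(n : ℝ) / 2) * Real.Gamma (2 * γ / (2 * γ + n)) ^ (γ + n / 2) *
        ∫ x, ‖q x‖ ^ (γ + n / 2) := by
  obtain ⟨u, hu0, hu⟩ := hz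
  have hmem : ((u : L2 n), z • (u : L2 n)) ∈ (schrodingerOperator q).graph :=
    (LinearPMap.mem_graph_iff _).2 ⟨u, rfl, hu⟩
  rw [schrodingerOperator_graph] at hmem
  obtain ⟨-, hv, hpde⟩ := hmem
  set f : L2 n := (u : L2 n)
  have hn3 : (3 : ℝ) ≤ n := by exact_mod_cast hn
  have hfr : (Module.finrank ℝ (EuclideanSpace ℝ (Fin n)) : ℝ) = n := by simp
  have h := abs_im_rpow_le_of_weak_eigenfunction (q := q) (u := f) (z := z) hγ
    (ρ := γ + n / 2) (by rw [hfr]) (by linarith) hq (Lp.memLp f) hv hzim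
    (fun h0 => hu0 ((Lp.eq_zero_iff_ae_eq_zero).2 h0)) (fun ψ => by
      have e := (hpde ψ).2
      simp only [laplacian_apply_apply, Lp.toTemperedDistribution_apply, smul_eq_mul] at e
      have hs : ∫ x, ψ x * (z • f : L2 n) x = z * ∫ x, ψ x * f x := by
        rw [← integral_const_mul]
        refine integral_congr_ae ?_
        filter_upwards [Lp.coeFn_smul z f] with x hx
        rw [hx, Pi.smul_apply, smul_eq_mul]
        ring
      rw [hs] at e
      linear_combination -e)
  have e1 : γ / (γ + n / 2) = 2 * γ / (2 * γ + n) := by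
    field_simp
  have e2 : -((n : ℝ) / 2) = -(n : ℝ) / 2 := by ring
  rwa [hfr, e1, e2] at h
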